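/- **Setting.** Time is slotted, with one slot as unit of time and epochs $t\in\mathbb Z$. Let $(\mathrm{SNR}_u(t),\mathrm{SNR}_d(t))_{t\in\mathbb Z}$ be pairs of nonnegative random variables that are independent and identically distributed over $t$ (the two entries of a pair may be dependent). For $i\in\{u,d\}$ (uplink, downlink) the service rate in slot $t$ is $$R_i(t)=W_i\log_2(1+\mathrm{SNR}_i(t))-\sqrt{V_i(t)/L_i}\;f_Q^{-1}(e_i),\qquad V_i(t)=1-\frac1{(1+\mathrm{SNR}_i(t))^2},$$ with bandwidth $W_i>0$, blocklength $L_i\ge 1$, distortion probability $e_i\in(0,1)$ and $f_Q$ the complementary distribution function of the standard Gaussian law; assume $R_i(t)\ge 0$ almost surely. The effective capacity is $C_i(\theta)=-\frac1\theta\ln\mathbb E\,e^{-\theta R_i(0)}$; write $C_i=C_i(\theta_i,W_i,e_i)$ for its value at $\theta_i$. The uplink and the downlink are two FIFO queues in series, in steady state. With $q_i(t)$ the queue length just after the arrival $a_i(t)$ of epoch $t$, $q_i(t+1)=\max(q_i(t)-R_i(t),0)+a_i(t+1)$, where $q_i(t)=\sup_{n\ge0}\big(\sum_{j=0}^{n}a_i(t-j)-\sum_{j=1}^{n}R_i(t-j)\big)$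 is the steady-state solution. The uplink arrivals are constant, $a_u(t)=\lambda_u=\beta k_s/T_s$, and $a_d(t)=\frac{N\gamma}{\beta k_s}\min\big(q_u(s),R_u(s)\big)$ with $s=t-1-\delta_c$, where $\beta,T_s,\gamma>0$, the integers $k_s,N$ are at least $1$, and the integer $\delta_c\ge0$ is the calculation delay in slots. Let $\theta_u,\theta_d>0$ be the decay rates of the overflow probabilities: $\lim_{q_0\to\infty}\frac1{q_0}\ln\Pr\{q_i(0)\ge q_0\}=-\theta_i$. A package that enters queue $i$ at epoch $t$ leaves it after the least number $n$ of slots with $q_i(t)\le\sum_{k=0}^{n-1}R_i(t+k)$. Fix a package that enters the uplink at some epoch $t$; let $D_u$ be its uplink delay and $D_d$ its downlink delay, the downlink being entered at epoch $t+D_u+\delta_c$. With an integer sensing delay $\delta_s\ge0$ its cycle time is $D_c=\delta_s+D_u+\delta_c+D_d$. For thresholds $D_{u,\max},D_{d,\max}$ the package is dropped if $D_u\ge D_{u,\max}$ or $D_d\ge D_{d,\max}$; put $\epsilon_i=\Pr\{D_i\ge D_{i,\max}\}$ and $\epsilon_c=\Pr\{D_u\ge D_{u,\max}\text{ or }D_d\ge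 D_{d,\max}\}$. Let $D_{c,\max}$ be the largest value of $\delta_s+a+\delta_c+b$ with $0\le a\le D_{u,\max}$, $0\le b\le D_{d,\max}$. **Theorem 1 (Cycle time and package loss probability).** 1. For $i=u,d$: $C_i>0$, and $D_{i,\max}\sim-\dfrac{\ln\epsilon_i}{\theta_iC_i(\theta_i,W_i,e_i)}$ as $D_{i,\max}\to\infty$ (the ratio tends to $1$). 2. A package that is not dropped has $D_c<D_{c,\max}$. Moreover, for $D_{u,\max},D_{d,\max}\ge0$, $D_{c,\max}=D_{u,\max}+D_{d,\max}+(\delta_s+\delta_c)$; so $D_{c,\max}=D_{u,\max}+D_{d,\max}$ if the sensing and calculation delays vanish, and in general $D_{c,\max}\sim D_{u,\max}+D_{d,\max}$ as $D_{u,\max},D_{d,\max}\to\infty$. 3. $\epsilon_c\approx1-(1-\epsilon_u)(1-\epsilon_d)$ in the following senses. The two sides differ by at most $\min(\epsilon_u,\epsilon_d)$ for all thresholds; they are equal whenever the events $\{D_u\ge D_{u,\max}\}$ and $\{D_d\ge D_{d,\max}\}$ are independent; and $\ln\epsilon_c\sim\ln\big(1-(1-\epsilon_u)(1-\epsilon_d)\big)$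 as $D_{u,\max},D_{d,\max}\to\infty$. Also, if $\epsilon_u,\epsilon_d\in(0,1)$ are prescribed and the thresholds are chosen as $D_{i,\max}=-\ln\epsilon_i/(\theta_iC_i(\theta_i,W_i,e_i))$, then the resulting loss probability $\epsilon_c$ of the loop satisfies $\ln\epsilon_c\sim\ln\big(1-(1-\epsilon_u)(1-\epsilon_d)\big)$ as $\epsilon_u,\epsilon_d\to0^+$ jointly. -/

import Mathlib

open MeasureTheory ProbabilityTheory Filter Topology
open scoped ENNReal Asymptotics

noncomputable section

/-! ### Short-packet transmission rate and effective capacity -/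

/-- Complementary distribution function of the standard Gaussian law. -/
def gaussQ (x : ℝ) : ℝ := (gaussianReal 0 1).real (Set.Ioi x)

/-- Inverse of `gaussQ`; meaningful for arguments in `(0, 1)`. -/
def gaussQInv (e : ℝ) : ℝ := Function.invFun gaussQ e

/-- Physical-layer parameters of one wireless link: bandwidth, probability of irreparable
distortion, blocklength. -/
structure Link where
  bandwidth : ℝ
  distortion : ℝ
  blocklength : ℕ

/-- Channel dispersion `1 - 1 / (1 + SNR)²`. -/
def channelDispersion (snr : ℝ) : ℝ := 1 - 1 / (1 + snr) ^ 2

/-- Capacity at finite blocklength, `W log₂ (1 + SNR) - √(V / L) Q⁻¹(e)`. -/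
def Link.rate (l : Link) (snr : ℝ) : ℝ :=
  l.bandwidth * Real.logb 2 (1 + snr)
    - Real.sqrt (channelDispersion snr / l.blocklength) * gaussQInv l.distortion

/-- Effective capacity `-(1/θ) log E[exp (-θ R)]` of a random service rate `R`. -/
def effectiveCapacity {Ω : Type*} [MeasurableSpace Ω] (P : Measure Ω) (R : Ω → ℝ) (θ : ℝ) : ℝ :=
  -(1 / θ) * Real.log (∫ ω, Real.exp (-θ * R ω) ∂P)

/-! ### A slotted FIFO queue in steady state -/

/-- Backlog, just after the arrival of epoch `t`, of a queue that has been running since time `-∞`.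
The amount `a k` arrives at epoch `k` and the amount `r k` can be served in slot `k`, between the
epochs `k` and `k + 1`. The term with index `n` is the backlog at `t` if the queue was empty before
epoch `t - n` and not idle since; `⊤` stands for an unbounded backlog. -/
def backlog (a r : ℤ → ℝ) (t : ℤ) : ℝ≥0∞ :=
  ⨆ n : ℕ, ENNReal.ofReal
    (∑ j ∈ Finset.range (n + 1), a (t - j) - ∑ j ∈ Finset.range n, r (t - 1 - j))

/-- The backlog obeys Lindley's recursion. -/
theorem backlog_succ (a r : ℤ → ℝ) (ha : ∀ t, 0 ≤ a t) (hr : ∀ t, 0 ≤ r t) (t : ℤ) :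
    backlog a r (t + 1) = (backlog a r t - ENNReal.ofReal (r t)) + ENNReal.ofReal (a (t + 1)) := by
  have key : ∀ n : ℕ, ENNReal.ofReal (∑ j ∈ Finset.range (n + 2), a (t + 1 - j)
        - ∑ j ∈ Finset.range (n + 1), r (t + 1 - 1 - j))
      ≤ ENNReal.ofReal (∑ j ∈ Finset.range (n + 1), a (t - j)
        - ∑ j ∈ Finset.range n, r (t - 1 - j)) - ENNReal.ofReal (r t)
        + ENNReal.ofReal (a (t + 1)) ∧
      ENNReal.ofReal (∑ j ∈ Finset.range (n + 1), a (t - j)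
        - ∑ j ∈ Finset.range n, r (t - 1 - j)) - ENNReal.ofReal (r t)
        + ENNReal.ofReal (a (t + 1)) ≤ max (ENNReal.ofReal (a (t + 1)))
        (ENNReal.ofReal (∑ j ∈ Finset.range (n + 2), a (t + 1 - j)
        - ∑ j ∈ Finset.range (n + 1), r (t + 1 - 1 - j))) := by
    intro n
    have e1 : ∑ j ∈ Finset.range (n + 2), a (t + 1 - j)
        = ∑ j ∈ Finset.range (n + 1), a (t - j) + a (t + 1) := by
      rw [Finset.sum_range_succ']
      simp only [Nat.cast_add, Nat.cast_one, Nat.cast_zero, sub_zero, add_sub_add_right_eq_sub]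
    have e2 : ∑ j ∈ Finset.range (n + 1), r (t + 1 - 1 - j)
        = ∑ j ∈ Finset.range n, r (t - 1 - j) + r t := by
      rw [Finset.sum_range_succ']
      congr 1
      · refine Finset.sum_congr rfl fun j _ => ?_
        congr 1; push_cast; ring
      · congr 1; push_cast; ring
    rw [e1, e2, ← ENNReal.ofReal_sub _ (hr t)]
    set A := ∑ j ∈ Finset.range (n + 1), a (t - j)
    set S := ∑ j ∈ Finset.range n, r (t - 1 - j)
    constructor
    · refine le_trans (le_of_eq ?_) ENNReal.ofReal_add_le
      congr 1; ring
    · rcases le_total (A - S - r t) 0 with h | h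
      · rw [ENNReal.ofReal_of_nonpos h, zero_add]; exact le_max_left _ _
      · rw [← ENNReal.ofReal_add h (ha _)]
        refine le_trans (le_of_eq ?_) (le_max_right _ _)
        congr 1; ring
  have h0 : ENNReal.ofReal (a (t + 1)) ≤ backlog a r (t + 1) := by
    refine le_trans (le_of_eq ?_) (le_iSup _ 0)
    simp
  refine le_antisymm ?_ ?_
  · refine iSup_le fun n => ?_
    cases n with
    | zero => simp
    | succ n =>
      refine (key n).1.trans ?_
      gcongr
      exact le_iSup (fun n : ℕ => ENNReal.ofReal (∑ j ∈ Finset.range (n + 1), a (t - j)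
        - ∑ j ∈ Finset.range n, r (t - 1 - j))) n
  · rw [backlog, ENNReal.iSup_sub, ENNReal.iSup_add]
    refine iSup_le fun n => (key n).2.trans (max_le h0 ?_)
    exact le_iSup (fun n : ℕ => ENNReal.ofReal (∑ j ∈ Finset.range (n + 1), a (t + 1 - j)
        - ∑ j ∈ Finset.range n, r (t + 1 - 1 - j))) (n + 1)

/-- Amount actually served in slot `t`. -/
def departure (a r : ℤ → ℝ) (t : ℤ) : ℝ := (min (backlog a r t) (ENNReal.ofReal (r t))).toReal

/-- Delay of what arrives at epoch `t`: the number of slots after which all the backlog present at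
epoch `t` has been served, `⊤` if that never happens. -/
def queueDelay (a r : ℤ → ℝ) (t : ℤ) : ℕ∞ :=
  ⨅ (n : ℕ) (_ : backlog a r t ≤ ENNReal.ofReal (∑ k ∈ Finset.range n, r (t + k))), (n : ℕ∞)

/-! ### The control loop: uplink and downlink queues in series -/

/-- Data of the control loop. The unit of time is one slot; `snrU t` and `snrD t` are the random
signal-to-noise ratios of the uplink and the downlink in slot `t`. -/
structure ControlLoop (Ω : Type*) where
  up : Link
  down : Link
  /-- size `β` of one piece of sensing data -/
  dataSize : ℝ
  /-- number `k_s` of sensors -/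
  sensors : ℕ
  /-- sensing period `T_s` -/
  period : ℝ
  /-- number `N` of control commands generated from `k_s` pieces of sensing data -/
  commands : ℕ
  /-- size `γ` of one control package -/
  commandSize : ℝ
  /-- sensing delay, in slots -/
  sensingDelay : ℕ
  /-- delay of the calculation of the commands, in slots -/
  calcDelay : ℕ
  snrU : ℤ → Ω → ℝ
  snrD : ℤ → Ω → ℝ

namespace ControlLoop

variable {Ω : Type*} (M : ControlLoop Ω)

/-- Service rate of the uplink in slot `t`. -/
def rateU (t : ℤ) (ω : Ω) : ℝ := M.up.rate (M.snrU t ω)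

/-- Service rate of the downlink in slot `t`. -/
def rateD (t : ℤ) (ω : Ω) : ℝ := M.down.rate (M.snrD t ω)

/-- Arrival rate `β k_s / T_s` of the uplink queue. -/
def arrivalU : ℝ := M.dataSize * M.sensors / M.period

/-- Steady-state length of the uplink queue at epoch `t`. -/
def queueU (t : ℤ) (ω : Ω) : ℝ≥0∞ := backlog (fun _ => M.arrivalU) (fun k => M.rateU k ω) t

/-- Arrival of the downlink queue at epoch `t`: the data that left the uplink in slot `s` becomes
`N γ / (β k_s)` times as much command data, available at epoch `s + 1 + calcDelay`. -/
def arrivalD (ω : Ω) (t : ℤ) : ℝ :=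
  M.commands * M.commandSize / (M.dataSize * M.sensors) *
    departure (fun _ => M.arrivalU) (fun k => M.rateU k ω) (t - 1 - M.calcDelay)

/-- Steady-state length of the downlink queue at epoch `t`. -/
def queueD (t : ℤ) (ω : Ω) : ℝ≥0∞ := backlog (M.arrivalD ω) (fun k => M.rateD k ω) t

/-- Uplink delay of the package that enters the uplink at epoch `t`. -/
def delayU (t : ℤ) (ω : Ω) : ℕ∞ := queueDelay (fun _ => M.arrivalU) (fun k => M.rateU k ω) t

/-- Downlink delay of the package that entered the uplink at epoch `t`: it enters the downlink at
epoch `t + delayU + calcDelay`. (If `delayU = ⊤`, the package never gets there; this value is then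
immaterial, since the package is lost and its cycle time is `⊤`.) -/
def delayD (t : ℤ) (ω : Ω) : ℕ∞ :=
  queueDelay (M.arrivalD ω) (fun k => M.rateD k ω) (t + (M.delayU t ω).toNat + M.calcDelay)

/-- Cycle time of the package that enters the uplink at epoch `t`. -/
def cycleTime (t : ℤ) (ω : Ω) : ℕ∞ :=
  M.sensingDelay + M.delayU t ω + M.calcDelay + M.delayD t ω

/-- The event that the uplink delay reaches the threshold `x`, so that the package is dropped. -/
def lossEventU (t : ℤ) (x : ℝ) : Set Ω := {ω | ENNReal.ofReal x ≤ (M.delayU t ω : ℝ≥0∞)}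

/-- The event that the downlink delay reaches the threshold `y`, so that the package is dropped. -/
def lossEventD (t : ℤ) (y : ℝ) : Set Ω := {ω | ENNReal.ofReal y ≤ (M.delayD t ω : ℝ≥0∞)}

/-- Maximum value of the cycle time that is possible when the uplink delay is at most `x` and the
downlink delay is at most `y`. -/
def maxCycleTime (x y : ℝ) : ℝ :=
  sSup {T : ℝ | ∃ a ∈ Set.Icc 0 x, ∃ b ∈ Set.Icc 0 y, T = M.sensingDelay + a + M.calcDelay + b}

variable [MeasurableSpace Ω] (P : Measure Ω)

/-- Package loss probability of the uplink queue with delay threshold `x`. -/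
def lossU (t : ℤ) (x : ℝ) : ℝ := P.real (M.lossEventU t x)

/-- Package loss probability of the downlink queue with delay threshold `y`. -/
def lossD (t : ℤ) (y : ℝ) : ℝ := P.real (M.lossEventD t y)

/-- Package loss probability of the loop: the package is dropped in one of the two queues. -/
def lossC (t : ℤ) (x y : ℝ) : ℝ := P.real (M.lossEventU t x ∪ M.lossEventD t y)

/-- Effective capacity of the uplink. -/
def capU (θ : ℝ) : ℝ := effectiveCapacity P (M.rateU 0) θ

/-- Effective capacity of the downlink. -/
def capD (θ : ℝ) : ℝ := effectiveCapacity P (M.rateD 0) θ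

/-- Standing assumptions on the parameters and on the channels: the pairs of uplink and downlink
signal-to-noise ratios are independent and identically distributed over the slots, and service
rates are nonnegative. -/
structure IsAdmissible : Prop where
  bandwidth_pos : 0 < M.up.bandwidth ∧ 0 < M.down.bandwidth
  distortion_mem : M.up.distortion ∈ Set.Ioo 0 1 ∧ M.down.distortion ∈ Set.Ioo 0 1
  blocklength_pos : 0 < M.up.blocklength ∧ 0 < M.down.blocklength
  dataSize_pos : 0 < M.dataSize
  sensors_pos : 0 < M.sensors
  period_pos : 0 < M.period
  commands_pos : 0 < M.commands
  commandSize_pos : 0 < M.commandSize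
  measurable_snr : ∀ t, Measurable (M.snrU t) ∧ Measurable (M.snrD t)
  snr_nonneg : ∀ t, ∀ᵐ ω ∂P, 0 ≤ M.snrU t ω ∧ 0 ≤ M.snrD t ω
  indep : iIndepFun (fun t ω => (M.snrU t ω, M.snrD t ω)) P
  identDistrib : ∀ t, IdentDistrib (fun ω => (M.snrU t ω, M.snrD t ω))
    (fun ω => (M.snrU 0 ω, M.snrD 0 ω)) P P
  rate_nonneg : ∀ t, ∀ᵐ ω ∂P, 0 ≤ M.rateU t ω ∧ 0 ≤ M.rateD t ω

end ControlLoop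

/-- `θ` is the decay rate of the overflow probability of a queue with steady-state length `q`:
`ln Pr{q ≥ q₀} / q₀ → -θ` as `q₀ → ∞`. -/
def IsOverflowDecayRate {Ω : Type*} [MeasurableSpace Ω] (P : Measure Ω) (q : Ω → ℝ≥0∞) (θ : ℝ) :
    Prop :=
  Tendsto (fun q₀ : ℝ => Real.log (P.real {ω | ENNReal.ofReal q₀ ≤ q ω}) / q₀) atTop (𝓝 (-θ))

end

set_option linter.unusedSectionVars false

/-! ### Deterministic facts about the queue -/

/-! With nonnegative service, the delay exceeds `m` slots exactly when the service of the next `m`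
slots falls short of the backlog. The uplink backlog at `t` depends on slots before `t`, that
service on slots from `t` on, so they are independent and `Pr{D > m} = E[Pr{q > S_m}]`. Since `Pr{q
> s}` is roughly `exp (-θ s)`, this is roughly `E[exp (-θ R)] ^ m = exp (-θ C(θ) m)`. Bounds at the
rates `θ ± η` and continuity of the Laplace transform make this precise (`tendsto_log_delay_div`).

The downlink is entered at a random epoch that depends on the uplink delay, so the queue met there
(`entryQueueD`) need not have the stationary law. Given `D_u = n`, it is still determined by slots
before the entry epoch, and the integral formula survives (`measure_lt_delayD_eq_lintegral`). Its
decay rate is `θ_d` as well. Unless `D_u > m`, the entry queue is one of `m + 1` stationary queues.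
Conversely, the queue at a fixed epoch exceeds that met by one of the last packages by at most the
command data of one package. Taking `m` linear in the level makes `Pr{D_u > m}` negligible, and the
factor `m + 1` does not change the exponential rate (`HasDecayRate.of_sandwich`).

The capacities are positive because a service rate that vanishes almost surely would make the
backlog infinite, against a positive decay rate. Finally `ε_c` and `1 - (1 - ε_u)(1 - ε_d)` both lie
between the maximum and the sum of the two probabilities, hence agree up to a factor 2, which is
lost in the logarithm. -/

theorem lt_queueDelay_iff_forall (a r : ℤ → ℝ) (t : ℤ) (m : ℕ) :
    (m : ℕ∞) < queueDelay a r t ↔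
      ∀ n ≤ m, ENNReal.ofReal (∑ k ∈ Finset.range n, r (t + k)) < backlog a r t := by
  rw [← ENat.add_one_le_iff (ENat.natCast_ne_top m), queueDelay, le_iInf₂_iff]
  refine forall_congr' fun n => ?_
  rw [← not_le (a := backlog a r t)]
  have : ((m : ℕ∞) + 1 ≤ n) ↔ ¬ n ≤ m := by
    rw [not_le]; exact_mod_cast Nat.succ_le_iff
  rw [this]
  tauto

theorem sum_range_service_mono {r : ℤ → ℝ} (hr : ∀ t, 0 ≤ r t) (t : ℤ) {n m : ℕ} (h : n ≤ m) :
    ∑ k ∈ Finset.range n, r (t + k) ≤ ∑ k ∈ Finset.range m, r (t + k) :=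
  Finset.sum_le_sum_of_subset_of_nonneg (Finset.range_mono h) fun _ _ _ => hr _

/-- Partial sums of nonnegative service increase, so only the last condition counts. The version
without signs serves measurability, since rates are nonnegative only almost surely. -/
theorem lt_queueDelay_iff (a : ℤ → ℝ) {r : ℤ → ℝ} (hr : ∀ t, 0 ≤ r t) (t : ℤ) (m : ℕ) :
    (m : ℕ∞) < queueDelay a r t ↔
      ENNReal.ofReal (∑ k ∈ Finset.range m, r (t + k)) < backlog a r t := by
  rw [lt_queueDelay_iff_forall]
  exact ⟨fun h => h m le_rfl, fun h n hn =>
    (ENNReal.ofReal_le_ofReal (sum_range_service_mono hr t hn)).trans_lt h⟩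

theorem backlog_shift (a r : ℤ → ℝ) (t s : ℤ) :
    backlog a r (t + s) = backlog (fun k => a (k + s)) (fun k => r (k + s)) t := by
  unfold backlog
  refine iSup_congr fun n => ?_
  congr 2
  · exact Finset.sum_congr rfl fun j _ => by congr 1; ring
  · exact Finset.sum_congr rfl fun j _ => by congr 1; ring

theorem departure_shift (a r : ℤ → ℝ) (t s : ℤ) :
    departure a r (t + s) = departure (fun k => a (k + s)) (fun k => r (k + s)) t := by
  unfold departure
  rw [backlog_shift]

theorem queueDelay_shift (a r : ℤ → ℝ) (t s : ℤ) :
    queueDelay a r (t + s) = queueDelay (fun k => a (k + s)) (fun k => r (k + s)) t := by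
  have h : ∀ n : ℕ, ∑ k ∈ Finset.range n, r (t + s + k) = ∑ k ∈ Finset.range n, r (t + k + s) :=
    fun n => Finset.sum_congr rfl fun j _ => by congr 1; ring
  unfold queueDelay
  simp only [backlog_shift, h]

theorem arrival_le_backlog (a r : ℤ → ℝ) (t : ℤ) : ENNReal.ofReal (a t) ≤ backlog a r t := by
  refine le_trans (le_of_eq ?_) (le_iSup _ 0)
  simp

theorem departure_nonneg (a r : ℤ → ℝ) (t : ℤ) : 0 ≤ departure a r t := ENNReal.toReal_nonneg

theorem departure_le (a : ℤ → ℝ) {r : ℤ → ℝ} (hr : ∀ t, 0 ≤ r t) (t : ℤ) :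
    departure a r t ≤ r t :=
  ENNReal.toReal_le_of_le_ofReal (hr t) (min_le_right _ _)

theorem min_le_departure (a : ℤ → ℝ) {r : ℤ → ℝ} (t : ℤ) :
    min (a t) (r t) ≤ departure a r t := by
  unfold departure
  rw [← ENNReal.ofReal_le_iff_le_toReal (ne_top_of_le_ne_top ENNReal.ofReal_ne_top
    (min_le_right _ _))]
  refine le_min ((ENNReal.ofReal_le_ofReal (min_le_left _ _)).trans (arrival_le_backlog a r t))
    (ENNReal.ofReal_le_ofReal (min_le_right _ _))

theorem one_le_queueDelay {a : ℤ → ℝ} (r : ℤ → ℝ) {t : ℤ} (ha : 0 < a t) :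
    1 ≤ queueDelay a r t := by
  have h : ((0 : ℕ) : ℕ∞) < queueDelay a r t := by
    rw [lt_queueDelay_iff_forall]
    intro n hn
    obtain rfl : n = 0 := by omega
    refine lt_of_lt_of_le ?_ (arrival_le_backlog a r t)
    simpa using ha
  simpa using Order.one_le_iff_pos.2 h

theorem backlog_add_le {a r : ℤ → ℝ} (ha : ∀ t, 0 ≤ a t) (hr : ∀ t, 0 ≤ r t) (t : ℤ) (j : ℕ) :
    backlog a r (t + j) ≤
      backlog a r t + ENNReal.ofReal (∑ i ∈ Finset.range j, a (t + 1 + i)) := by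
  induction j with
  | zero => simp
  | succ j ih =>
    have e : t + ((j + 1 : ℕ) : ℤ) = t + j + 1 := by push_cast; ring
    rw [e, backlog_succ a r ha hr, Finset.sum_range_succ,
      ENNReal.ofReal_add (Finset.sum_nonneg fun _ _ => ha _) (ha _), ← add_assoc]
    refine add_le_add (tsub_le_self.trans ih) (le_of_eq ?_)
    congr 2; ring

/-- Between the departure of one package and the departure of the next one, at most the size of the
latter is served. -/
theorem sum_service_le_of_lt_queueDelay {a r : ℤ → ℝ} (ha : ∀ t, 0 ≤ a t) (hr : ∀ t, 0 ≤ r t)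
    {t : ℤ} {d j : ℕ} (h₁ : queueDelay a r t ≤ ((d + 1 : ℕ) : ℕ∞))
    (h₂ : ((d + j : ℕ) : ℕ∞) < queueDelay a r (t + 1)) :
    ∑ i ∈ Finset.range j, r (t + (d + 1 : ℕ) + i) ≤ a (t + 1) := by
  rw [← not_lt, lt_queueDelay_iff a hr, not_lt, Finset.sum_range_succ'] at h₁
  rw [lt_queueDelay_iff a hr, backlog_succ a r ha hr] at h₂
  have e1 : ∑ k ∈ Finset.range d, r (t + ((k + 1 : ℕ) : ℤ))
      = ∑ k ∈ Finset.range d, r (t + 1 + k) :=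
    Finset.sum_congr rfl fun k _ => by congr 1; push_cast; ring
  have e2 : ∑ k ∈ Finset.range (d + j), r (t + 1 + k)
      = ∑ k ∈ Finset.range d, r (t + 1 + k) + ∑ i ∈ Finset.range j, r (t + (d + 1 : ℕ) + i) := by
    rw [Finset.sum_range_add]
    congr 1
    exact Finset.sum_congr rfl fun k _ => by congr 1; push_cast; ring
  have h0 : 0 ≤ ∑ k ∈ Finset.range d, r (t + 1 + k) := Finset.sum_nonneg fun _ _ => hr _
  rw [e1, ENNReal.ofReal_add h0 (hr _)] at h₁
  -- What is left of the older backlog after slot `t` fits into the `d` following slots; only the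
  -- new arrival can occupy the server beyond them.
  have h3 : backlog a r t - ENNReal.ofReal (r t)
      ≤ ENNReal.ofReal (∑ k ∈ Finset.range d, r (t + 1 + k)) := by
    rw [tsub_le_iff_right]; simpa using h₁
  have h4 := h₂.trans_le (add_le_add_left h3 (ENNReal.ofReal (a (t + 1))))
  rw [← ENNReal.ofReal_add h0 (ha _), e2] at h4
  have := lt_of_not_ge fun h => h4.not_ge (ENNReal.ofReal_le_ofReal h)
  linarith

/-- If the package of epoch `t - M` has left by epoch `t`, there is a last package that has done so,
and since then at most the size of one package has been served. -/
theorem exists_last_departure {a r : ℤ → ℝ} (ha : ∀ t, 0 < a t) (hr : ∀ t, 0 ≤ r t) {t : ℤ} {M : ℕ}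
    (h : queueDelay a r (t - M) ≤ M) :
    ∃ n ≤ M, ∃ d j : ℕ, d + j = n ∧ queueDelay a r (t - n) = d ∧
      ∑ i ∈ Finset.range j, r (t - n + d + i) ≤ a (t - n + 1) := by
  classical
  -- The least such `n` belongs to the latest package gone by epoch `t`; by minimality its successor
  -- is still present.
  have hex : ∃ n : ℕ, queueDelay a r (t - n) ≤ n := ⟨M, h⟩
  obtain ⟨n, hn, hmin⟩ : ∃ n : ℕ, queueDelay a r (t - n) ≤ n ∧
      ∀ m < n, ¬ queueDelay a r (t - m) ≤ m :=
    ⟨Nat.find hex, Nat.find_spec hex, fun m hm => Nat.find_min hex hm⟩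
  have hnM : n ≤ M := by
    by_contra hc
    exact hmin M (not_le.1 hc) h
  obtain ⟨d', hd'⟩ := ENat.ne_top_iff_exists.1 (ne_top_of_le_ne_top (ENat.natCast_ne_top n) hn)
  have h1 := one_le_queueDelay r (ha (t - n))
  rw [← hd'] at hn h1
  have hdn : d' ≤ n := by exact_mod_cast hn
  have hd1 : 1 ≤ d' := by exact_mod_cast h1
  obtain ⟨d, rfl⟩ : ∃ d, d' = d + 1 := ⟨d' - 1, by omega⟩
  obtain ⟨j, rfl⟩ := Nat.exists_eq_add_of_le hdn
  refine ⟨_, hnM, d + 1, j, rfl, hd'.symm, ?_⟩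
  refine sum_service_le_of_lt_queueDelay (fun t => (ha t).le) hr hd'.symm.le ?_
  have h2 := not_le.1 (hmin (d + j) (by omega))
  have e : t - ((d + 1 + j : ℕ) : ℤ) + 1 = t - ((d + j : ℕ) : ℤ) := by push_cast; ring
  rw [e]
  exact h2

/-! ### Exponential tails -/

/-- The tail `Pr{Q > s}` decays like `exp (-θ s)` on the logarithmic scale. -/
def HasDecayRate {Ω : Type*} [MeasurableSpace Ω] (P : Measure Ω) (Q : Ω → ℝ≥0∞) (θ : ℝ) : Prop :=
  ∀ η > 0, ∀ᶠ s : ℝ in atTop, Real.exp (-(θ + η) * s) ≤ P.real {ω | ENNReal.ofReal s < Q ω} ∧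
    P.real {ω | ENNReal.ofReal s < Q ω} ≤ Real.exp (-(θ - η) * s)

section Tails

variable {Ω : Type*} [MeasurableSpace Ω] {P : Measure Ω} [IsProbabilityMeasure P]

theorem IsOverflowDecayRate.hasDecayRate {Q : Ω → ℝ≥0∞} {θ : ℝ} (hθ : 0 < θ)
    (h : IsOverflowDecayRate P Q θ) : HasDecayRate P Q θ := by
  intro η hη
  set f : ℝ → ℝ := fun s => P.real {ω | ENNReal.ofReal s ≤ Q ω} with hf
  have hup : ∀ᶠ s : ℝ in atTop, Real.log (f s) / s < -θ + η :=
    h.eventually (gt_mem_nhds (by linarith))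
  have hlo : ∀ᶠ s : ℝ in atTop, -θ - η / 2 < Real.log (f s) / s :=
    h.eventually (lt_mem_nhds (by linarith))
  have hneg : ∀ᶠ s : ℝ in atTop, Real.log (f s) / s < 0 :=
    h.eventually (gt_mem_nhds (by linarith))
  have hshift : Tendsto (fun s : ℝ => s + 1) atTop atTop :=
    tendsto_atTop_add_const_right _ _ tendsto_id
  filter_upwards [hup, hshift.eventually hlo, hshift.eventually hneg, eventually_gt_atTop 0,
    -- This threshold gives `(θ + η / 2) * (s + 1) ≤ (θ + η) * s`, which pays for passing from `≤`
    -- at `s + 1` to `<` at `s`.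
    eventually_ge_atTop ((θ + η / 2) / (η / 2))] with s h1 h2 h3 hs h4
  constructor
  · have hs1 : 0 < s + 1 := by linarith
    -- `Real.log 0 = 0`, so a negative quotient excludes probability zero.
    have hpos : 0 < f (s + 1) := by
      refine lt_of_le_of_ne measureReal_nonneg fun h0 => ?_
      rw [← h0] at h3
      simp at h3
    have h5 : Real.exp (-(θ + η) * s) ≤ f (s + 1) := by
      rw [← Real.le_log_iff_exp_le hpos]
      rw [lt_div_iff₀ hs1] at h2
      rw [div_le_iff₀ (by linarith)] at h4
      nlinarith
    refine h5.trans (measureReal_mono fun ω (hω : _ ≤ Q ω) => ?_)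
    exact ((ENNReal.ofReal_lt_ofReal_iff hs1).2 (by linarith)).trans_le hω
  · have hle : P.real {ω | ENNReal.ofReal s < Q ω} ≤ f s :=
      measureReal_mono fun ω (hω : _ < Q ω) => hω.le
    refine hle.trans ?_
    have hf0 : 0 ≤ f s := measureReal_nonneg
    rcases hf0.eq_or_lt with h0 | h0
    · rw [← h0]; positivity
    · rw [← Real.log_le_iff_le_exp h0]
      rw [div_lt_iff₀ hs] at h1
      linarith

/-- A constant absorbs the range where the eventual bound is not available. A bound valid at every
level can be integrated over the law of the service. -/
theorem HasDecayRate.exists_le {Q : Ω → ℝ≥0∞} {θ η : ℝ} (h : HasDecayRate P Q θ) (hη : 0 < η)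
    (hηθ : η < θ) : ∃ C > 0, ∀ s : ℝ,
      P.real {ω | ENNReal.ofReal s < Q ω} ≤ C * Real.exp (-(θ - η) * s) := by
  obtain ⟨s₀, hs₀⟩ := eventually_atTop.1 (h η hη)
  set s₁ := max s₀ 0
  refine ⟨Real.exp ((θ - η) * s₁), Real.exp_pos _, fun s => ?_⟩
  rw [← Real.exp_add]
  rcases le_total s s₁ with hs | hs
  · refine measureReal_le_one.trans (Real.one_le_exp ?_)
    nlinarith
  · refine (hs₀ s ((le_max_left _ _).trans hs)).2.trans (Real.exp_le_exp.2 ?_)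
    nlinarith [mul_nonneg (sub_nonneg.2 hηθ.le) (le_max_right s₀ 0)]

theorem HasDecayRate.exists_ge {Q : Ω → ℝ≥0∞} {θ η : ℝ} (h : HasDecayRate P Q θ) (hη : 0 < η) :
    ∃ c > 0, ∀ s : ℝ, 0 ≤ s →
      c * Real.exp (-(θ + η) * s) ≤ P.real {ω | ENNReal.ofReal s < Q ω} := by
  obtain ⟨s₀, hs₀⟩ := eventually_atTop.1 (h η hη)
  set s₁ := max s₀ 0
  refine ⟨Real.exp (-(θ + η) * s₁), Real.exp_pos _, fun s hs => ?_⟩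
  have h1 := (hs₀ (s + s₁) (by linarith [le_max_left s₀ 0])).1
  rw [← Real.exp_add, ← mul_add, add_comm s₁ s]
  refine h1.trans (measureReal_mono fun ω (hω : _ < Q ω) => ?_)
  exact (ENNReal.ofReal_le_ofReal (by linarith [le_max_right s₀ 0])).trans_lt hω

/-- Probability one has logarithm zero, against a negative limit. This is what an almost surely
infinite backlog contradicts. -/
theorem IsOverflowDecayRate.exists_measure_ne_one {Q : Ω → ℝ≥0∞} {θ : ℝ} (hθ : 0 < θ)
    (h : IsOverflowDecayRate P Q θ) :
    ∃ s : ℝ, 0 < s ∧ P {ω | ENNReal.ofReal s ≤ Q ω} ≠ 1 := by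
  have hneg := h.eventually (gt_mem_nhds (show -θ < 0 by linarith))
  obtain ⟨s, hs, hs0⟩ := (hneg.and (eventually_gt_atTop 0)).exists
  refine ⟨s, hs0, fun h1 => ?_⟩
  simp [measureReal_def, h1] at hs

/-- Comparison of an independent pair through its marginals. -/
theorem measure_lt_of_indepFun {Q S : Ω → ℝ≥0∞} (hQ : Measurable Q) (hS : Measurable S)
    (h : IndepFun Q S P) : P {ω | S ω < Q ω} = ∫⁻ s, P {ω | s < Q ω} ∂(P.map S) := by
  have h' := (indepFun_iff_map_prod_eq_prod_map_map hS.aemeasurable hQ.aemeasurable).1 h.symm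
  have hm : MeasurableSet {p : ℝ≥0∞ × ℝ≥0∞ | p.1 < p.2} :=
    measurableSet_lt measurable_fst measurable_snd
  have h1 : P {ω | S ω < Q ω} = P.map (fun ω => (S ω, Q ω)) {p | p.1 < p.2} := by
    rw [Measure.map_apply (hS.prodMk hQ) hm]; rfl
  rw [h1, h', Measure.prod_apply hm]
  refine lintegral_congr fun s => ?_
  rw [Measure.map_apply hQ (measurable_prodMk_left hm)]
  rfl

theorem eventually_lt_log_div {p : ℕ → ℝ} {c x b : ℝ} (hc : 0 < c) (hx : 0 < x)
    (hp : ∀ m, c * x ^ m ≤ p m) (hb : b < Real.log x) :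
    ∀ᶠ m : ℕ in atTop, b < Real.log (p m) / m := by
  have h1 : Tendsto (fun m : ℕ => Real.log c / m + Real.log x) atTop (𝓝 (0 + Real.log x)) :=
    (tendsto_const_div_atTop_nhds_zero_nat _).add tendsto_const_nhds
  rw [zero_add] at h1
  filter_upwards [h1.eventually (lt_mem_nhds hb), eventually_gt_atTop 0] with m hm hm0
  refine hm.trans_le ?_
  have hm0' : (0 : ℝ) < m := by exact_mod_cast hm0
  rw [le_div_iff₀ hm0', add_mul, div_mul_cancel₀ _ hm0'.ne']
  have := Real.log_le_log (by positivity) (hp m)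
  rw [Real.log_mul hc.ne' (by positivity), Real.log_pow] at this
  linarith

theorem eventually_log_div_lt {p : ℕ → ℝ} {c x b : ℝ} (hc : 0 < c) (hx : 0 < x) (hp0 : ∀ m, 0 < p m)
    (hp : ∀ m, p m ≤ c * x ^ m) (hb : Real.log x < b) :
    ∀ᶠ m : ℕ in atTop, Real.log (p m) / m < b := by
  have h1 : Tendsto (fun m : ℕ => Real.log c / m + Real.log x) atTop (𝓝 (0 + Real.log x)) :=
    (tendsto_const_div_atTop_nhds_zero_nat _).add tendsto_const_nhds
  rw [zero_add] at h1
  filter_upwards [h1.eventually (gt_mem_nhds hb), eventually_gt_atTop 0] with m hm hm0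
  refine lt_of_le_of_lt ?_ hm
  have hm0' : (0 : ℝ) < m := by exact_mod_cast hm0
  rw [div_le_iff₀ hm0', add_mul, div_mul_cancel₀ _ hm0'.ne']
  have := Real.log_le_log (hp0 m) (hp m)
  rw [Real.log_mul hc.ne' (by positivity), Real.log_pow] at this
  linarith

theorem integrable_exp_neg_mul {X : Ω → ℝ} (hX : AEMeasurable X P) (hnn : ∀ᵐ ω ∂P, 0 ≤ X ω) {a : ℝ}
    (ha : 0 ≤ a) : Integrable (fun ω => Real.exp (-a * X ω)) P := by
  refine Integrable.of_bound (C := 1)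
    (Real.measurable_exp.comp_aemeasurable (hX.const_mul _)).aestronglyMeasurable ?_
  filter_upwards [hnn] with ω hω
  rw [Real.norm_of_nonneg (Real.exp_pos _).le, Real.exp_le_one_iff]
  nlinarith

theorem continuousAt_mgf_neg {X : Ω → ℝ} (hX : AEMeasurable X P) (hnn : ∀ᵐ ω ∂P, 0 ≤ X ω) {a : ℝ}
    (ha : 0 < a) : ContinuousAt (fun b => mgf X P (-b)) a := by
  have hsub : Set.Iio (0 : ℝ) ⊆ integrableExpSet X P := fun b hb => by
    have := integrable_exp_neg_mul hX hnn (a := -b) (by simpa using (le_of_lt hb))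
    simpa [integrableExpSet] using this
  have hmem : -a ∈ interior (integrableExpSet X P) :=
    interior_maximal hsub isOpen_Iio (by simpa using ha)
  have h1 : ContinuousAt (mgf X P) (-a) :=
    continuousOn_mgf.continuousAt (isOpen_interior.mem_nhds hmem)
  exact ContinuousAt.comp (f := fun b : ℝ => -b) h1 continuous_neg.continuousAt

/-- A nonnegative random variable whose exponential moment at a negative argument is at least one
vanishes almost surely. -/
theorem ae_eq_zero_of_one_le_integral_exp {X : Ω → ℝ} (hX : AEMeasurable X P)
    (hnn : ∀ᵐ ω ∂P, 0 ≤ X ω) {a : ℝ} (ha : 0 < a) (h : 1 ≤ ∫ ω, Real.exp (-a * X ω) ∂P) :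
    ∀ᵐ ω ∂P, X ω = 0 := by
  have hint := integrable_exp_neg_mul hX hnn ha.le
  have h0 : ∀ᵐ ω ∂P, 0 ≤ 1 - Real.exp (-a * X ω) := by
    filter_upwards [hnn] with ω hω
    rw [sub_nonneg, Real.exp_le_one_iff]
    nlinarith
  have hi : ∫ ω, (1 - Real.exp (-a * X ω)) ∂P = 0 := by
    refine le_antisymm ?_ (integral_nonneg_of_ae h0)
    rw [integral_sub (integrable_const _) hint]
    simpa using h
  rw [integral_eq_zero_iff_of_nonneg_ae h0 ((integrable_const _).sub hint)] at hi
  filter_upwards [hi] with ω hω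
  have h1 : Real.exp (-a * X ω) = 1 := by
    have : 1 - Real.exp (-a * X ω) = 0 := hω
    linarith
  rw [Real.exp_eq_one_iff] at h1
  simpa [ha.ne'] using h1

end Tails

/-! ### Delay decay from backlog decay and independent service. -/

section Delay

variable {Ω : Type*} [MeasurableSpace Ω] {P : Measure Ω} [IsProbabilityMeasure P] {R : ℤ → Ω → ℝ}

/-- The injection `e` covers both consecutive slots of service and, running backwards, the uplink
slots that feed the downlink. -/
theorem integral_exp_neg_sum (hmeas : ∀ t, Measurable (R t)) (hind : iIndepFun R P)
    (hid : ∀ t, IdentDistrib (R t) (R 0) P P) (a : ℝ) {e : ℕ → ℤ} (he : Function.Injective e)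
    (m : ℕ) :
    ∫ ω, Real.exp (-a * ∑ k ∈ Finset.range m, R (e k) ω) ∂P = mgf (R 0) P (-a) ^ m := by
  have h1 := (hind.precomp he).mgf_sum (t := -a) (fun k => hmeas _) (Finset.range m)
  simp only [mgf_congr_identDistrib (hid _), Finset.prod_const, Finset.card_range] at h1
  rw [← h1, mgf]
  simp [Finset.sum_apply]

theorem lintegral_exp_neg_sum (hmeas : ∀ t, Measurable (R t)) (hind : iIndepFun R P)
    (hid : ∀ t, IdentDistrib (R t) (R 0) P P) (hnn : ∀ t, ∀ᵐ ω ∂P, 0 ≤ R t ω) {a c : ℝ} (ha : 0 ≤ a)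
    (hc : 0 ≤ c) (t : ℤ) (m : ℕ) :
    ∫⁻ ω, ENNReal.ofReal (c * Real.exp (-a * ∑ k ∈ Finset.range m, R (t + k) ω)) ∂P
      = ENNReal.ofReal (c * mgf (R 0) P (-a) ^ m) := by
  have hsum : ∀ᵐ ω ∂P, 0 ≤ ∑ k ∈ Finset.range m, R (t + k) ω := by
    filter_upwards [ae_all_iff.2 hnn] with ω hω using Finset.sum_nonneg fun _ _ => hω _
  have hint := integrable_exp_neg_mul (P := P)
    (Finset.measurable_fun_sum (Finset.range m) fun k _ => hmeas (t + k)).aemeasurable hsum ha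
  rw [← integral_exp_neg_sum hmeas hind hid a (e := fun k => t + k)
      (fun i j hij => by simpa using hij) m, ← integral_const_mul,
    ofReal_integral_eq_lintegral_ofReal (hint.const_mul c)]
  exact Eventually.of_forall fun ω => by positivity

/-- Delay asymptotics: if the backlog `Q` has decay rate `θ` and the delay exceeds `m` slots exactly
when an independent copy of the service of `m` slots falls short of `Q`, then the decay rate of the
delay is the logarithm of the Laplace transform of the service rate at `θ`. -/
theorem tendsto_log_delay_div (hmeas : ∀ t, Measurable (R t)) (hind : iIndepFun R P)
    (hid : ∀ t, IdentDistrib (R t) (R 0) P P) (hnn : ∀ t, ∀ᵐ ω ∂P, 0 ≤ R t ω) {Q : Ω → ℝ≥0∞} {θ : ℝ}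
    (hθ : 0 < θ) (hQ : HasDecayRate P Q θ) (t : ℤ) {p : ℕ → ℝ} (hp0 : ∀ m, 0 ≤ p m)
    (hp : ∀ m, ENNReal.ofReal (p m) = ∫⁻ ω,
      P {ω' | ENNReal.ofReal (∑ k ∈ Finset.range m, R (t + k) ω) < Q ω'} ∂P) :
    (∀ m, 0 < p m) ∧
      Tendsto (fun m : ℕ => Real.log (p m) / m) atTop (𝓝 (Real.log (mgf (R 0) P (-θ)))) := by
  have hpos : ∀ a, 0 ≤ a → 0 < mgf (R 0) P (-a) := fun a ha =>
    mgf_pos (integrable_exp_neg_mul (hmeas 0).aemeasurable (hnn 0) ha)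
  have hsum : ∀ m : ℕ, ∀ᵐ ω ∂P, 0 ≤ ∑ k ∈ Finset.range m, R (t + k) ω := fun m => by
    filter_upwards [ae_all_iff.2 hnn] with ω hω using Finset.sum_nonneg fun _ _ => hω _
  -- Integrating the tail bounds at the rates `θ + η` and `θ - η` over the service gives geometric
  -- bounds on `p`; letting `η` tend to zero closes the gap.
  have hlow : ∀ η > 0, ∃ c > 0, ∀ m, c * mgf (R 0) P (-(θ + η)) ^ m ≤ p m := by
    intro η hη
    obtain ⟨c, hc, h⟩ := hQ.exists_ge hη
    refine ⟨c, hc, fun m => ?_⟩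
    rw [← ENNReal.ofReal_le_ofReal_iff (hp0 m), hp m,
      ← lintegral_exp_neg_sum hmeas hind hid hnn (by linarith) hc.le t m]
    refine lintegral_mono_ae ?_
    filter_upwards [hsum m] with ω hω
    rw [← ENNReal.ofReal_toReal (measure_ne_top P _)]
    exact ENNReal.ofReal_le_ofReal (h _ hω)
  have hupp : ∀ η > 0, η < θ → ∃ c > 0, ∀ m, p m ≤ c * mgf (R 0) P (-(θ - η)) ^ m := by
    intro η hη hηθ
    obtain ⟨c, hc, h⟩ := hQ.exists_le hη hηθ
    refine ⟨c, hc, fun m => ?_⟩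
    have hpos' := hpos (θ - η) (by linarith)
    rw [← ENNReal.ofReal_le_ofReal_iff (by positivity), hp m,
      ← lintegral_exp_neg_sum hmeas hind hid hnn (by linarith) hc.le t m]
    refine lintegral_mono fun ω => ?_
    rw [← ENNReal.ofReal_toReal (measure_ne_top P _)]
    exact ENNReal.ofReal_le_ofReal (h _)
  have hp_pos : ∀ m, 0 < p m := fun m => by
    obtain ⟨c, hc, h⟩ := hlow 1 one_pos
    have := hpos (θ + 1) (by linarith)
    exact lt_of_lt_of_le (by positivity) (h m)
  have hcont : ContinuousAt (fun a => Real.log (mgf (R 0) P (-a))) θ :=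
    (continuousAt_mgf_neg (hmeas 0).aemeasurable (hnn 0) hθ).log (hpos θ hθ.le).ne'
  have hadd : Tendsto (fun η : ℝ => Real.log (mgf (R 0) P (-(θ + η)))) (𝓝[>] 0)
      (𝓝 (Real.log (mgf (R 0) P (-θ)))) := by
    refine hcont.tendsto.comp (tendsto_nhdsWithin_of_tendsto_nhds ?_)
    exact (continuous_const.add continuous_id).tendsto' _ _ (by simp)
  have hsub : Tendsto (fun η : ℝ => Real.log (mgf (R 0) P (-(θ - η)))) (𝓝[>] 0)
      (𝓝 (Real.log (mgf (R 0) P (-θ)))) := by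
    refine hcont.tendsto.comp (tendsto_nhdsWithin_of_tendsto_nhds ?_)
    exact (continuous_const.sub continuous_id).tendsto' _ _ (by simp)
  refine ⟨hp_pos, tendsto_order.2 ⟨fun b hb => ?_, fun b hb => ?_⟩⟩
  · obtain ⟨η, hη1, hη⟩ := ((hadd.eventually (lt_mem_nhds hb)).and self_mem_nhdsWithin).exists
    obtain ⟨c, hc, h⟩ := hlow η hη
    exact eventually_lt_log_div hc (hpos _ (by linarith)) h hη1
  · obtain ⟨η, ⟨hη1, hη2⟩, hη⟩ := (((hsub.eventually (gt_mem_nhds hb)).and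
      (nhdsWithin_le_nhds (gt_mem_nhds hθ))).and self_mem_nhdsWithin).exists
    obtain ⟨c, hc, h⟩ := hupp η hη hη2
    exact eventually_log_div_lt hc (hpos _ (by linarith)) hp_pos h hη1

end Delay

/-! ### Measurability -/

theorem Link.measurable_rate (l : Link) : Measurable l.rate := by
  unfold Link.rate channelDispersion Real.logb
  fun_prop

theorem measurable_backlog {Ω : Type*} [MeasurableSpace Ω] {a r : Ω → ℤ → ℝ} {t : ℤ}
    (ha : ∀ j : ℕ, Measurable fun ω => a ω (t - j))
    (hr : ∀ j : ℕ, Measurable fun ω => r ω (t - 1 - j)) :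
    Measurable fun ω => backlog (a ω) (r ω) t := by
  unfold backlog
  refine Measurable.iSup fun n => ENNReal.measurable_ofReal.comp ?_
  exact (Finset.measurable_fun_sum _ fun j _ => ha j).sub
    (Finset.measurable_fun_sum _ fun j _ => hr j)

theorem measurable_apply_nat {Ω β : Type*} [MeasurableSpace Ω] [MeasurableSpace β] {F : ℕ → Ω → β}
    (hF : ∀ n, Measurable (F n)) {N : Ω → ℕ} (hN : Measurable N) : Measurable fun ω => F (N ω) ω :=
  (measurable_from_prod_countable_right (f := Function.uncurry F) hF).comp (hN.prodMk measurable_id)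

namespace ControlLoop

/-- Length of the downlink queue when the package that entered the uplink at epoch `t` enters the
downlink. -/
noncomputable def entryQueueD {Ω : Type*} (M : ControlLoop Ω) (t : ℤ) (ω : Ω) : ℝ≥0∞ :=
  M.queueD (t + (M.delayU t ω).toNat + M.calcDelay) ω

section Measurability

variable {Ω : Type*} [MeasurableSpace Ω] {M : ControlLoop Ω} {T : ℤ}

theorem measurable_rateU {k : ℤ} (h : Measurable (M.snrU k)) : Measurable (M.rateU k) :=
  M.up.measurable_rate.comp h

theorem measurable_rateD {k : ℤ} (h : Measurable (M.snrD k)) : Measurable (M.rateD k) :=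
  M.down.measurable_rate.comp h

/-- Only the slots before `T` are assumed measurable. Applied with the σ-algebra of these slots in
place of the ambient one, this and the next lemmas say that the queue depends on the past alone. -/
theorem measurable_queueU (h : ∀ k < T, Measurable (M.snrU k) ∧ Measurable (M.snrD k)) {t : ℤ}
    (ht : t ≤ T) : Measurable (M.queueU t) :=
  measurable_backlog (fun _ => measurable_const) fun j => measurable_rateU (h _ (by omega)).1

theorem measurable_arrivalD (h : ∀ k < T, Measurable (M.snrU k) ∧ Measurable (M.snrD k)) {t : ℤ}
    (ht : t ≤ T) : Measurable fun ω => M.arrivalD ω t := by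
  have hs : t - 1 - M.calcDelay < T := by omega
  exact ((Measurable.min (measurable_queueU h hs.le)
    (measurable_rateU (h _ hs).1).ennreal_ofReal).ennreal_toReal).const_mul _

theorem measurable_queueD (h : ∀ k < T, Measurable (M.snrU k) ∧ Measurable (M.snrD k)) {t : ℤ}
    (ht : t ≤ T) : Measurable (M.queueD t) :=
  measurable_backlog (fun j => measurable_arrivalD h (by omega))
    fun j => measurable_rateD (h _ (by omega)).2

theorem measurableSet_lt_delayU (h : ∀ k < T, Measurable (M.snrU k) ∧ Measurable (M.snrD k))
    {t : ℤ} {n : ℕ} (ht : t + n ≤ T) : MeasurableSet {ω | (n : ℕ∞) < M.delayU t ω} := by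
  simp only [delayU, lt_queueDelay_iff_forall, Set.ofPred_forall]
  refine MeasurableSet.iInter fun m => MeasurableSet.iInter fun hm => ?_
  refine measurableSet_lt (ENNReal.measurable_ofReal.comp ?_) (measurable_queueU h (by omega))
  refine Finset.measurable_fun_sum _ fun k hk => measurable_rateU (h _ ?_).1
  have := Finset.mem_range.1 hk
  omega

/-- Slots before `t + n` decide whether the delay equals `n`: the departure epoch is a stopping
time. -/
theorem measurableSet_delayU_eq (h : ∀ k < T, Measurable (M.snrU k) ∧ Measurable (M.snrD k))
    {t : ℤ} {n : ℕ} (ht : t + n ≤ T) : MeasurableSet {ω | M.delayU t ω = n} := by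
  have e : {ω | M.delayU t ω = n} = {ω | (n : ℕ∞) < M.delayU t ω}ᶜ ∩
      ⋂ m : Fin n, {ω | ((m : ℕ) : ℕ∞) < M.delayU t ω} := by
    ext ω
    simp only [Set.mem_ofPred_eq, Set.mem_inter_iff, Set.mem_compl_iff, Set.mem_iInter, not_lt]
    constructor
    · rintro hω
      rw [hω]
      exact ⟨le_rfl, fun m => by exact_mod_cast m.2⟩
    · rintro ⟨h1, h2⟩
      obtain ⟨d, hd⟩ := ENat.ne_top_iff_exists.1 (ne_top_of_le_ne_top (ENat.natCast_ne_top n) h1)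
      rw [← hd] at h1 h2 ⊢
      have h1' : d ≤ n := by exact_mod_cast h1
      by_contra hne
      have hlt : d < n := lt_of_le_of_ne h1' fun he => hne (by rw [he])
      exact lt_irrefl _ (h2 ⟨d, hlt⟩)
  rw [e]
  refine (measurableSet_lt_delayU h ht).compl.inter (MeasurableSet.iInter fun m => ?_)
  have := m.2
  exact measurableSet_lt_delayU h (by omega)

theorem measurable_delayU (h : ∀ k, Measurable (M.snrU k) ∧ Measurable (M.snrD k)) (t : ℤ) :
    Measurable (M.delayU t) := by
  refine measurable_to_countable' fun y => ?_
  induction y using ENat.recTopCoe with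
  | top =>
    have e : M.delayU t ⁻¹' {⊤} = ⋂ n : ℕ, {ω | (n : ℕ∞) < M.delayU t ω} := by
      ext ω
      simp [ENat.eq_top_iff_forall_gt]
    rw [e]
    exact MeasurableSet.iInter fun n => measurableSet_lt_delayU (fun k _ => h k) le_rfl
  | coe n => exact measurableSet_delayU_eq (fun k _ => h k) le_rfl

theorem measurable_toNat_delayU (h : ∀ k, Measurable (M.snrU k) ∧ Measurable (M.snrD k)) (t : ℤ) :
    Measurable fun ω => (M.delayU t ω).toNat :=
  Measurable.comp (g := ENat.toNat) (measurable_to_nat fun _ => trivial) (measurable_delayU h t)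

theorem measurable_entryQueueD (h : ∀ k, Measurable (M.snrU k) ∧ Measurable (M.snrD k)) (t : ℤ) :
    Measurable (M.entryQueueD t) :=
  measurable_apply_nat (F := fun n => M.queueD (t + n + M.calcDelay))
    (fun n => measurable_queueD (T := t + n + M.calcDelay) (fun k _ => h k) le_rfl)
    (measurable_toNat_delayU h t)

theorem measurableSet_lt_delayD (h : ∀ k, Measurable (M.snrU k) ∧ Measurable (M.snrD k)) (t : ℤ)
    (m : ℕ) : MeasurableSet {ω | (m : ℕ∞) < M.delayD t ω} := by
  simp only [delayD, lt_queueDelay_iff_forall, Set.ofPred_forall]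
  refine MeasurableSet.iInter fun n => MeasurableSet.iInter fun _ => ?_
  refine measurableSet_lt (Measurable.ennreal_ofReal ?_) (measurable_entryQueueD h t)
  refine Finset.measurable_fun_sum _ fun k _ => ?_
  exact measurable_apply_nat (F := fun n => M.rateD (t + n + M.calcDelay + k))
    (fun n => measurable_rateD (h _).2) (measurable_toNat_delayU h t)

end Measurability

/-! ### Stationarity -/

section Path

variable {Ω : Type*} (M : ControlLoop Ω)

/-- The sequence of the pairs of signal-to-noise ratios. -/
def path (ω : Ω) (k : ℤ) : ℝ × ℝ := (M.snrU k ω, M.snrD k ω)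

/-- The loop on the space of sequences of pairs of signal-to-noise ratios. -/
def pathLoop : ControlLoop (ℤ → ℝ × ℝ) where
  up := M.up
  down := M.down
  dataSize := M.dataSize
  sensors := M.sensors
  period := M.period
  commands := M.commands
  commandSize := M.commandSize
  sensingDelay := M.sensingDelay
  calcDelay := M.calcDelay
  snrU k ξ := (ξ k).1
  snrD k ξ := (ξ k).2

theorem pathLoop_measurable (k : ℤ) :
    Measurable (M.pathLoop.snrU k) ∧ Measurable (M.pathLoop.snrD k) :=
  ⟨measurable_fst.comp (measurable_pi_apply k), measurable_snd.comp (measurable_pi_apply k)⟩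

theorem queueU_eq_shift (t : ℤ) (ω : Ω) :
    M.queueU t ω = M.pathLoop.queueU 0 fun k => M.path ω (k + t) := by
  have := backlog_shift (fun _ => M.arrivalU) (fun k => M.rateU k ω) 0 t
  rw [zero_add] at this
  exact this

theorem delayU_eq_shift (t : ℤ) (ω : Ω) :
    M.delayU t ω = M.pathLoop.delayU 0 fun k => M.path ω (k + t) := by
  have := queueDelay_shift (fun _ => M.arrivalU) (fun k => M.rateU k ω) 0 t
  rw [zero_add] at this
  exact this

theorem arrivalD_add (s t : ℤ) (ω : Ω) :
    M.arrivalD ω (s + t) = M.pathLoop.arrivalD (fun k => M.path ω (k + t)) s := by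
  have := departure_shift (fun _ => M.arrivalU) (fun k => M.rateU k ω) (s - 1 - M.calcDelay) t
  unfold arrivalD
  rw [show s + t - 1 - (M.calcDelay : ℤ) = s - 1 - M.calcDelay + t by ring, this]
  rfl

theorem queueD_add (s t : ℤ) (ω : Ω) :
    M.queueD (s + t) ω = M.pathLoop.queueD s fun k => M.path ω (k + t) := by
  have := backlog_shift (M.arrivalD ω) (fun k => M.rateD k ω) s t
  simp only [arrivalD_add] at this
  exact this

theorem entryQueueD_eq_shift (t : ℤ) (ω : Ω) :
    M.entryQueueD t ω = M.pathLoop.entryQueueD 0 fun k => M.path ω (k + t) := by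
  unfold entryQueueD
  rw [← delayU_eq_shift, ← queueD_add]
  congr 1
  change _ = 0 + _ + (M.calcDelay : ℤ) + t
  ring

end Path

section Stationary

variable {Ω : Type*} [MeasurableSpace Ω] {P : Measure Ω} [IsProbabilityMeasure P]
  {M : ControlLoop Ω}

theorem IsAdmissible.measurable_path (hM : M.IsAdmissible P) (k : ℤ) :
    Measurable fun ω => M.path ω k :=
  (hM.measurable_snr k).1.prodMk (hM.measurable_snr k).2

/-- By independence the law is the product of its marginals, which are the same in all slots. Since
the queues and delays are fixed functions of the shifted path, their laws do not depend on the
epoch. -/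
theorem IsAdmissible.map_path_shift (hM : M.IsAdmissible P) (t : ℤ) :
    P.map (fun ω k => M.path ω (k + t))
      = Measure.infinitePi fun _ => P.map fun ω => M.path ω 0 := by
  have hi : iIndepFun (fun k ω => M.path ω (k + t)) P :=
    hM.indep.precomp (g := fun k : ℤ => k + t) (add_left_injective t)
  rw [(iIndepFun_iff_map_fun_eq_infinitePi_map fun k => hM.measurable_path (k + t)).1 hi]
  congr 1
  funext k
  exact (hM.identDistrib (k + t)).map_eq

theorem IsAdmissible.measure_path_shift (hM : M.IsAdmissible P) {A : Set (ℤ → ℝ × ℝ)}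
    (hA : MeasurableSet A) (s t : ℤ) :
    P {ω | (fun k => M.path ω (k + s)) ∈ A} = P {ω | (fun k => M.path ω (k + t)) ∈ A} := by
  have h : ∀ s : ℤ, Measurable fun ω k => M.path ω (k + s) :=
    fun s => measurable_pi_lambda _ fun k => hM.measurable_path (k + s)
  have h1 := Measure.map_apply (μ := P) (h s) hA
  have h2 := Measure.map_apply (μ := P) (h t) hA
  rw [hM.map_path_shift] at h1 h2
  exact h1.symm.trans h2

theorem IsAdmissible.measure_lt_queueU (hM : M.IsAdmissible P) (c : ℝ≥0∞) (s t : ℤ) :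
    P {ω | c < M.queueU s ω} = P {ω | c < M.queueU t ω} := by
  simp only [queueU_eq_shift M s, queueU_eq_shift M t]
  exact hM.measure_path_shift (measurableSet_lt measurable_const
    (measurable_queueU (fun k _ => M.pathLoop_measurable k) le_rfl)) s t

theorem IsAdmissible.measure_lt_delayU (hM : M.IsAdmissible P) (n : ℕ) (s t : ℤ) :
    P {ω | (n : ℕ∞) < M.delayU s ω} = P {ω | (n : ℕ∞) < M.delayU t ω} := by
  simp only [delayU_eq_shift M s, delayU_eq_shift M t]
  exact hM.measure_path_shift (measurableSet_lt_delayU (fun k _ => M.pathLoop_measurable k) le_rfl)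
    s t

theorem IsAdmissible.measure_lt_queueD (hM : M.IsAdmissible P) (c : ℝ≥0∞) (s t : ℤ) :
    P {ω | c < M.queueD s ω} = P {ω | c < M.queueD t ω} := by
  rw [← zero_add s, ← zero_add t]
  simp only [queueD_add]
  exact hM.measure_path_shift (measurableSet_lt measurable_const
    (measurable_queueD (fun k _ => M.pathLoop_measurable k) le_rfl)) s t

theorem IsAdmissible.measure_lt_entryQueueD (hM : M.IsAdmissible P) (c : ℝ≥0∞) (s t : ℤ) :
    P {ω | c < M.entryQueueD s ω} = P {ω | c < M.entryQueueD t ω} := by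
  simp only [entryQueueD_eq_shift M s, entryQueueD_eq_shift M t]
  exact hM.measure_path_shift (measurableSet_lt measurable_const
    (measurable_entryQueueD M.pathLoop_measurable 0)) s t

theorem IsAdmissible.map_service (hM : M.IsAdmissible P) (m : ℕ) (s t : ℤ) :
    P.map (fun ω => ENNReal.ofReal (∑ k ∈ Finset.range m, M.rateD (s + k) ω))
      = P.map (fun ω => ENNReal.ofReal (∑ k ∈ Finset.range m, M.rateD (t + k) ω)) := by
  have hm : ∀ s : ℤ, Measurable fun ω =>
      ENNReal.ofReal (∑ k ∈ Finset.range m, M.rateD (s + k) ω) :=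
    fun s => (Finset.measurable_fun_sum _ fun k _ =>
      measurable_rateD (hM.measurable_snr _).2).ennreal_ofReal
  have hg : Measurable fun ξ : ℤ → ℝ × ℝ =>
      ENNReal.ofReal (∑ k ∈ Finset.range m, M.pathLoop.rateD k ξ) :=
    (Finset.measurable_fun_sum _ fun k _ =>
      measurable_rateD (M.pathLoop_measurable _).2).ennreal_ofReal
  have key : ∀ (B : Set ℝ≥0∞) (s : ℤ),
      (fun ω => ENNReal.ofReal (∑ k ∈ Finset.range m, M.rateD (s + k) ω)) ⁻¹' B
      = {ω | (fun k => M.path ω (k + s)) ∈ (fun ξ : ℤ → ℝ × ℝ =>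
        ENNReal.ofReal (∑ k ∈ Finset.range m, M.pathLoop.rateD k ξ)) ⁻¹' B} := by
    intro B s
    ext ω
    simp only [Set.mem_preimage, Set.mem_ofPred_eq, add_comm s]
    rfl
  ext B hB
  rw [Measure.map_apply (hm s) hB, Measure.map_apply (hm t) hB, key, key]
  exact hM.measure_path_shift (hg hB) s t

end Stationary

end ControlLoop

namespace ControlLoop

/-! ### Independence of the past and the future -/

section Independence

variable {Ω : Type*} [MeasurableSpace Ω] {P : Measure Ω} {M : ControlLoop Ω}

/-- The σ-algebra generated by the channels in the slots of `S`. -/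
@[reducible] def slotSigma {Ω : Type*} (M : ControlLoop Ω) (S : Set ℤ) : MeasurableSpace Ω :=
  ⨆ k ∈ S, MeasurableSpace.comap (fun ω => M.path ω k) inferInstance

theorem slotSigma_measurable {Ω : Type*} (M : ControlLoop Ω) {S : Set ℤ} {k : ℤ} (hk : k ∈ S) :
    Measurable[M.slotSigma S] (M.snrU k) ∧ Measurable[M.slotSigma S] (M.snrD k) := by
  have h : Measurable[M.slotSigma S] fun ω => M.path ω k :=
    measurable_iff_comap_le.2 (le_iSup₂_of_le k hk le_rfl)
  exact ⟨measurable_fst.comp h, measurable_snd.comp h⟩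

theorem IsAdmissible.indepFun_of_slots (hM : M.IsAdmissible P) {S T : Set ℤ} (hST : Disjoint S T)
    {f g : Ω → ℝ≥0∞} (hf : Measurable[M.slotSigma S] f) (hg : Measurable[M.slotSigma T] g) :
    IndepFun f g P := by
  have hle : ∀ k, MeasurableSpace.comap (fun ω => M.path ω k) inferInstance ≤ ‹MeasurableSpace Ω› :=
    fun k => measurable_iff_comap_le.1
      ((hM.measurable_snr k).1.prodMk (hM.measurable_snr k).2)
  have h := indep_iSup_of_disjoint hle hM.indep.iIndep hST
  rw [IndepFun_iff_Indep]
  exact indep_of_indep_of_le_left (indep_of_indep_of_le_right h (measurable_iff_comap_le.1 hg))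
    (measurable_iff_comap_le.1 hf)

theorem IsAdmissible.iIndepFun_comp (hM : M.IsAdmissible P) {g : ℝ × ℝ → ℝ} (hg : Measurable g) :
    iIndepFun (fun k ω => g (M.path ω k)) P :=
  hM.indep.comp (fun _ => g) fun _ => hg

theorem IsAdmissible.identDistrib_comp (hM : M.IsAdmissible P) {g : ℝ × ℝ → ℝ} (hg : Measurable g)
    (k : ℤ) : IdentDistrib (fun ω => g (M.path ω k)) (fun ω => g (M.path ω 0)) P P :=
  (hM.identDistrib k).comp hg

theorem measurable_up_rate_fst (M : ControlLoop Ω) : Measurable fun p : ℝ × ℝ => M.up.rate p.1 :=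
  M.up.measurable_rate.comp measurable_fst

theorem measurable_down_rate_snd (M : ControlLoop Ω) :
    Measurable fun p : ℝ × ℝ => M.down.rate p.2 :=
  M.down.measurable_rate.comp measurable_snd

theorem IsAdmissible.iIndepFun_rateU (hM : M.IsAdmissible P) : iIndepFun M.rateU P :=
  hM.iIndepFun_comp M.measurable_up_rate_fst

theorem IsAdmissible.iIndepFun_rateD (hM : M.IsAdmissible P) : iIndepFun M.rateD P :=
  hM.iIndepFun_comp M.measurable_down_rate_snd

theorem IsAdmissible.identDistrib_rateU (hM : M.IsAdmissible P) (t : ℤ) :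
    IdentDistrib (M.rateU t) (M.rateU 0) P P :=
  hM.identDistrib_comp M.measurable_up_rate_fst t

theorem IsAdmissible.identDistrib_rateD (hM : M.IsAdmissible P) (t : ℤ) :
    IdentDistrib (M.rateD t) (M.rateD 0) P P :=
  hM.identDistrib_comp M.measurable_down_rate_snd t

theorem IsAdmissible.ae_rate_nonneg (hM : M.IsAdmissible P) :
    ∀ᵐ ω ∂P, (∀ t, 0 ≤ M.rateU t ω) ∧ ∀ t, 0 ≤ M.rateD t ω := by
  filter_upwards [ae_all_iff.2 hM.rate_nonneg] with ω hω
  exact ⟨fun t => (hω t).1, fun t => (hω t).2⟩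

theorem IsAdmissible.arrivalU_pos (hM : M.IsAdmissible P) : 0 < M.arrivalU := by
  have := hM.dataSize_pos
  have := hM.period_pos
  have : (0 : ℝ) < M.sensors := by exact_mod_cast hM.sensors_pos
  unfold arrivalU
  positivity

/-- Command data per unit of sensing data. -/
noncomputable def expansion {Ω : Type*} (M : ControlLoop Ω) : ℝ :=
  M.commands * M.commandSize / (M.dataSize * M.sensors)

theorem IsAdmissible.expansion_pos (hM : M.IsAdmissible P) : 0 < M.expansion := by
  have := hM.dataSize_pos
  have := hM.commandSize_pos
  have : (0 : ℝ) < M.sensors := by exact_mod_cast hM.sensors_pos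
  have : (0 : ℝ) < M.commands := by exact_mod_cast hM.commands_pos
  unfold expansion
  positivity

theorem IsAdmissible.arrivalD_nonneg (hM : M.IsAdmissible P) (ω : Ω) (t : ℤ) : 0 ≤ M.arrivalD ω t :=
  mul_nonneg hM.expansion_pos.le (departure_nonneg _ _ _)

end Independence

/-! ### Delay tails as integrals over the service -/

section DelayTail

variable {Ω : Type*} [MeasurableSpace Ω] {P : Measure Ω} [IsProbabilityMeasure P]
  {M : ControlLoop Ω}

/-- The slots before `t` determine the backlog, those from `t` on the service. -/
theorem IsAdmissible.measure_lt_delayU_eq_lintegral (hM : M.IsAdmissible P) (t : ℤ) (m : ℕ) :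
    P {ω | (m : ℕ∞) < M.delayU t ω} = ∫⁻ ω,
      P {ω' | ENNReal.ofReal (∑ k ∈ Finset.range m, M.rateU (t + k) ω) < M.queueU t ω'} ∂P := by
  have hQ : Measurable (M.queueU t) := measurable_queueU (fun k _ => hM.measurable_snr k) le_rfl
  have hS : Measurable fun ω => ENNReal.ofReal (∑ k ∈ Finset.range m, M.rateU (t + k) ω) :=
    (Finset.measurable_fun_sum _ fun k _ =>
      measurable_rateU (hM.measurable_snr _).1).ennreal_ofReal
  have hind : IndepFun (M.queueU t)
      (fun ω => ENNReal.ofReal (∑ k ∈ Finset.range m, M.rateU (t + k) ω)) P := by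
    refine hM.indepFun_of_slots (S := Set.Iio t) (T := Set.Ici t)
      (Set.Iio_disjoint_Ici le_rfl) ?_ ?_
    · exact @measurable_queueU Ω (M.slotSigma (Set.Iio t)) M t
        (fun k hk => M.slotSigma_measurable hk) t le_rfl
    · refine @Measurable.ennreal_ofReal Ω (M.slotSigma (Set.Ici t)) _
        (Finset.measurable_fun_sum _ fun k _ => ?_)
      exact @measurable_rateU Ω (M.slotSigma (Set.Ici t)) M _
        (M.slotSigma_measurable (by simp)).1
  have h1 : P {ω | (m : ℕ∞) < M.delayU t ω} = P {ω |
      ENNReal.ofReal (∑ k ∈ Finset.range m, M.rateU (t + k) ω) < M.queueU t ω} := by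
    refine measure_congr ?_
    filter_upwards [hM.ae_rate_nonneg] with ω hω
    exact propext (lt_queueDelay_iff _ hω.1 t m)
  have hmeas : Measurable fun s : ℝ≥0∞ => P {ω | s < M.queueU t ω} :=
    Antitone.measurable fun s s' hs => measure_mono fun ω (hω : s' < _) => hs.trans_lt hω
  rw [h1, measure_lt_of_indepFun hQ hS hind, lintegral_map hmeas hS]

/-- Splitting according to `D_u = n` makes the entry epoch deterministic, with past and future
independent. `hfin` discards the paths with `D_u = ⊤`, where `toNat` would give a spurious entry
epoch. -/
theorem IsAdmissible.measure_lt_delayD_eq_lintegral (hM : M.IsAdmissible P) (t : ℤ) (m : ℕ)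
    (hfin : ∀ᵐ ω ∂P, M.delayU t ω ≠ ⊤) :
    P {ω | (m : ℕ∞) < M.delayD t ω} = ∫⁻ ω,
      P {ω' | ENNReal.ofReal (∑ k ∈ Finset.range m, M.rateD (0 + k) ω)
        < M.entryQueueD t ω'} ∂P := by
  set τ : ℕ → ℤ := fun n => t + n + M.calcDelay with hτ
  set S : ℤ → Ω → ℝ≥0∞ := fun T ω => ENNReal.ofReal (∑ k ∈ Finset.range m, M.rateD (T + k) ω)
    with hSdef
  set E : ℕ → Set Ω := fun n => {ω | M.delayU t ω = n} with hE
  -- Since nothing is strictly below zero, `s < Q n` already contains the event `D_u = n`.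
  set Q : ℕ → Ω → ℝ≥0∞ := fun n => (E n).indicator (M.queueD (τ n)) with hQdef
  have hQ_meas : ∀ n, Measurable[M.slotSigma (Set.Iio (τ n))] (Q n) := fun n => by
    refine Measurable.indicator (m := M.slotSigma (Set.Iio (τ n))) ?_ ?_
    · exact @measurable_queueD Ω (M.slotSigma (Set.Iio (τ n))) M (τ n)
        (fun k hk => M.slotSigma_measurable hk) (τ n) le_rfl
    · exact @measurableSet_delayU_eq Ω (M.slotSigma (Set.Iio (τ n))) M (τ n)
        (fun k hk => M.slotSigma_measurable hk) t n (by simp [hτ])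
  have hS_meas : ∀ n, Measurable[M.slotSigma (Set.Ici (τ n))] (S (τ n)) := fun n => by
    refine @Measurable.ennreal_ofReal Ω (M.slotSigma (Set.Ici (τ n))) _
      (Finset.measurable_fun_sum _ fun k _ => ?_)
    exact @measurable_rateD Ω (M.slotSigma (Set.Ici (τ n))) M _
      (M.slotSigma_measurable (by simp)).2
  have hE' : ∀ n, MeasurableSet (E n) := fun n =>
    measurableSet_delayU_eq (T := t + n) (fun k _ => hM.measurable_snr k) le_rfl
  have hQ : ∀ n, Measurable (Q n) := fun n =>
    (measurable_queueD (T := τ n) (fun k _ => hM.measurable_snr k) le_rfl).indicator (hE' n)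
  have hS : ∀ T, Measurable (S T) := fun T =>
    (Finset.measurable_fun_sum _ fun k _ =>
      measurable_rateD (hM.measurable_snr _).2).ennreal_ofReal
  have hEdisj : ∀ i j, i ≠ j → ∀ ω, ω ∈ E i → ω ∉ E j := fun i j hij ω hi hj => by
    have h1 : M.delayU t ω = i := hi
    have h2 : M.delayU t ω = j := hj
    exact hij (by exact_mod_cast h1.symm.trans h2)
  have hQpos : ∀ n ω (s : ℝ≥0∞), s < Q n ω ↔ ω ∈ E n ∧ s < M.queueD (τ n) ω := fun n ω s => by
    by_cases h : ω ∈ E n <;> simp [hQdef, h]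
  have hentry : ∀ n ω, ω ∈ E n → M.entryQueueD t ω = M.queueD (τ n) ω := fun n ω hω => by
    have h1 : M.delayU t ω = n := hω
    simp [entryQueueD, h1, hτ]
  have hEex : ∀ ω, M.delayU t ω ≠ ⊤ → ∃ n, ω ∈ E n := fun ω hω => by
    obtain ⟨d, hd⟩ := ENat.ne_top_iff_exists.1 hω
    exact ⟨d, hd.symm⟩
  have hmono : ∀ n, Measurable fun s : ℝ≥0∞ => P {ω | s < Q n ω} := fun n =>
    Antitone.measurable fun s s' hs => measure_mono fun ω (hω : s' < _) => hs.trans_lt hω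
  have hmono' : Measurable fun s : ℝ≥0∞ => P {ω | s < M.entryQueueD t ω} :=
    Antitone.measurable fun s s' hs => measure_mono fun ω (hω : s' < _) => hs.trans_lt hω
  have h1 : P {ω | (m : ℕ∞) < M.delayD t ω} = P (⋃ n, {ω | S (τ n) ω < Q n ω}) := by
    refine measure_congr ?_
    filter_upwards [hM.ae_rate_nonneg, hfin] with ω hω hω'
    refine propext ((lt_queueDelay_iff _ hω.2 _ m).trans ?_)
    obtain ⟨n, hn⟩ := hEex ω hω'
    have hd : M.delayU t ω = n := hn
    change _ ↔ ω ∈ ⋃ n, {ω | S (τ n) ω < Q n ω}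
    rw [Set.mem_iUnion]
    constructor
    · intro h
      refine ⟨n, (hQpos n ω _).2 ⟨hn, ?_⟩⟩
      rw [hd] at h
      exact h
    · rintro ⟨n', h'⟩
      obtain ⟨hn', h''⟩ := (hQpos n' ω _).1 h'
      have hd' : M.delayU t ω = n' := hn'
      rw [hd']
      exact h''
  have h2 : ∀ s : ℝ≥0∞, P {ω | s < M.entryQueueD t ω} = ∑' n, P {ω | s < Q n ω} := by
    intro s
    rw [← measure_iUnion]
    · refine measure_congr ?_
      filter_upwards [hfin] with ω hω'
      obtain ⟨n, hn⟩ := hEex ω hω'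
      refine propext ?_
      change s < M.entryQueueD t ω ↔ ω ∈ ⋃ n, {ω | s < Q n ω}
      rw [Set.mem_iUnion]
      constructor
      · exact fun h => ⟨n, (hQpos n ω _).2 ⟨hn, hentry n ω hn ▸ h⟩⟩
      · rintro ⟨n', h'⟩
        obtain ⟨hn', h''⟩ := (hQpos n' ω _).1 h'
        rw [hentry n' ω hn']
        exact h''
    · exact fun i j hij => Set.disjoint_left.2 fun ω hi hj =>
        hEdisj i j hij ω ((hQpos i ω s).1 hi).1 ((hQpos j ω s).1 hj).1
    · exact fun n => measurableSet_lt measurable_const (hQ n)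
  calc P {ω | (m : ℕ∞) < M.delayD t ω} = ∑' n, P {ω | S (τ n) ω < Q n ω} := by
        rw [h1, measure_iUnion]
        · exact fun i j hij => Set.disjoint_left.2 fun ω hi hj =>
            hEdisj i j hij ω ((hQpos i ω _).1 hi).1 ((hQpos j ω _).1 hj).1
        · exact fun n => measurableSet_lt (hS _) (hQ n)
    _ = ∑' n, ∫⁻ s, P {ω | s < Q n ω} ∂(P.map (S 0)) := by
        -- The law of the service does not depend on its starting epoch, so one measure serves all
        -- `n` and the terms can be summed again.
        refine tsum_congr fun n => ?_
        rw [measure_lt_of_indepFun (hQ n) (hS (τ n)) (hM.indepFun_of_slots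
          (Set.Iio_disjoint_Ici le_rfl) (hQ_meas n) (hS_meas n)),
          hM.map_service m (τ n) 0]
    _ = ∫⁻ s, P {ω | s < M.entryQueueD t ω} ∂(P.map (S 0)) := by
        rw [← lintegral_tsum fun n => (hmono n).aemeasurable]
        exact lintegral_congr fun s => (h2 s).symm
    _ = _ := lintegral_map hmono' (hS 0)

end DelayTail

end ControlLoop

/-! ### Decay rates of comparable tails. -/

theorem tendsto_affine_mul_exp_neg {K C η : ℝ} (hη : 0 < η) :
    Tendsto (fun s : ℝ => (K * s + C) * Real.exp (-η * s)) atTop (𝓝 0) := by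
  have h1 := tendsto_rpow_mul_exp_neg_mul_atTop_nhds_zero 1 η hη
  have h0 := tendsto_rpow_mul_exp_neg_mul_atTop_nhds_zero 0 η hη
  have h2 := (h1.const_mul K).add (h0.const_mul C)
  simp only [mul_zero, add_zero, Real.rpow_one, Real.rpow_zero, one_mul] at h2
  exact h2.congr fun s => by ring

/-- Two tails that bound each other up to a linear number of terms and an exponentially small
error in this number have the same decay rate. -/
theorem HasDecayRate.of_sandwich {Ω : Type*} [MeasurableSpace Ω] {P : Measure Ω} {Q Q' : Ω → ℝ≥0∞}
    {θ ρ b : ℝ} {p : ℕ → ℝ} (hθ : 0 < θ) (hρ : 0 < ρ) (hQ : HasDecayRate P Q θ)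
    (hp : ∀ᶠ n : ℕ in atTop, p n ≤ Real.exp (-ρ * n))
    (h₁ : ∀ (s : ℝ) (n : ℕ), P.real {ω | ENNReal.ofReal s < Q' ω}
      ≤ (n + 1) * P.real {ω | ENNReal.ofReal s < Q ω} + p n)
    (h₂ : ∀ (s : ℝ) (n : ℕ), 0 ≤ s → P.real {ω | ENNReal.ofReal (s + b) < Q ω}
      ≤ (n + 1) * P.real {ω | ENNReal.ofReal s < Q' ω} + p n) : HasDecayRate P Q' θ := by
  intro η hη
  -- With `n = ⌈K * s⌉₊` the error `p n` is at most `exp (-(θ + η) * s)`.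
  set K := (θ + η) / ρ with hK
  have hK0 : 0 < K := by positivity
  have hKs : Tendsto (fun s : ℝ => ⌈K * s⌉₊) atTop atTop :=
    tendsto_nat_ceil_atTop.comp (tendsto_id.const_mul_atTop hK0)
  have hshift : Tendsto (fun s : ℝ => s + b) atTop atTop :=
    tendsto_atTop_add_const_right _ _ tendsto_id
  -- The factor `n + 1` is at most `K * s + 2`; the third unit accounts for `p n`.
  have hsmall := tendsto_affine_mul_exp_neg (K := K) (C := 3) (half_pos hη)
  filter_upwards [hQ (η / 2) (half_pos hη), hshift.eventually (hQ (η / 2) (half_pos hη)),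
    hKs.eventually hp, eventually_ge_atTop 0, hsmall.eventually (gt_mem_nhds one_pos),
    hsmall.eventually (gt_mem_nhds (Real.exp_pos (-(θ + η / 2) * b)))] with s hs hsb hps hs0 hs1 hs2
  set n := ⌈K * s⌉₊
  have hn : K * s ≤ n := Nat.le_ceil _
  have hn' : (n : ℝ) ≤ K * s + 1 := (Nat.ceil_lt_add_one (by positivity)).le
  have hpn : p n ≤ Real.exp (-(θ + η) * s) := by
    refine hps.trans (Real.exp_le_exp.2 ?_)
    have : ρ * (K * s) ≤ ρ * n := mul_le_mul_of_nonneg_left hn hρ.le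
    have e : ρ * (K * s) = (θ + η) * s := by rw [hK]; field_simp
    linarith
  constructor
  -- Otherwise the tail of `Q` at `s + b`, at least of order `exp (-(θ + η / 2) * s)`, would be at
  -- most an affine multiple of `exp (-(θ + η) * s)`.
  · by_contra hc
    rw [not_le] at hc
    have h := h₂ s n hs0
    have hexp := Real.exp_pos (-(θ + η) * s)
    have h3 : Real.exp (-(θ + η / 2) * (s + b)) ≤ (K * s + 3) * Real.exp (-(θ + η) * s) := by
      have := hsb.1
      have h4 : ((n : ℝ) + 1) * P.real {ω | ENNReal.ofReal s < Q' ω}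
          ≤ (K * s + 2) * Real.exp (-(θ + η) * s) :=
        mul_le_mul (by linarith) hc.le measureReal_nonneg (by positivity)
      linarith
    have e1 : Real.exp (-(θ + η / 2) * (s + b))
        = Real.exp (-(θ + η / 2) * b) * Real.exp (-(θ + η / 2) * s) := by
      rw [← Real.exp_add]; congr 1; ring
    have e2 : Real.exp (-(θ + η) * s)
        = Real.exp (-(η / 2) * s) * Real.exp (-(θ + η / 2) * s) := by
      rw [← Real.exp_add]; congr 1; ring
    rw [e1, e2, ← mul_assoc] at h3
    exact absurd (le_of_mul_le_mul_right h3 (Real.exp_pos _)) (not_le.2 hs2)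
  · have h := h₁ s n
    have h4 : ((n : ℝ) + 1) * P.real {ω | ENNReal.ofReal s < Q ω}
        ≤ (K * s + 2) * Real.exp (-(θ - η / 2) * s) :=
      mul_le_mul (by linarith) hs.2 measureReal_nonneg (by positivity)
    have h5 : Real.exp (-(θ + η) * s) ≤ Real.exp (-(θ - η / 2) * s) :=
      Real.exp_le_exp.2 (by nlinarith)
    have e2 : Real.exp (-(θ - η / 2) * s)
        = Real.exp (-(η / 2) * s) * Real.exp (-(θ - η) * s) := by
      rw [← Real.exp_add]; congr 1; ring
    calc P.real {ω | ENNReal.ofReal s < Q' ω}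
        ≤ (K * s + 3) * Real.exp (-(θ - η / 2) * s) := by linarith
      _ = ((K * s + 3) * Real.exp (-(η / 2) * s)) * Real.exp (-(θ - η) * s) := by rw [e2]; ring
      _ ≤ 1 * Real.exp (-(θ - η) * s) := by gcongr
      _ = _ := one_mul _

theorem measure_eq_one_of_ae {Ω : Type*} [MeasurableSpace Ω] {P : Measure Ω}
    [IsProbabilityMeasure P] {p : Ω → Prop} (h : ∀ᵐ ω ∂P, p ω) : P {ω | p ω} = 1 := by
  rw [measure_congr (eventuallyEq_univ.2 h), measure_univ]

namespace ControlLoop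

variable {Ω : Type*} [MeasurableSpace Ω] {P : Measure Ω} [IsProbabilityMeasure P]
  {M : ControlLoop Ω}

/-! ### The downlink queue seen by an entering package -/

theorem entryQueueD_of_delayU_eq {Ω : Type*} (M : ControlLoop Ω) {t : ℤ} {ω : Ω} {n : ℕ}
    (h : M.delayU t ω = n) : M.entryQueueD t ω = M.queueD (t + n + M.calcDelay) ω := by
  unfold entryQueueD
  rw [h, ENat.toNat_natCast]

/-- Between the last uplink departure by epoch `t` and `t` itself, the uplink serves at most one
package. The downlink queue therefore grows by at most the command data of that package. -/
theorem IsAdmissible.exists_queueD_le (hM : M.IsAdmissible P) {ω : Ω} (hU : ∀ t, 0 ≤ M.rateU t ω)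
    (hD : ∀ t, 0 ≤ M.rateD t ω) {t : ℤ} {m : ℕ} (h : M.delayU (t - m) ω ≤ m) :
    ∃ n ≤ m, M.queueD (t + M.calcDelay) ω
      ≤ M.entryQueueD (t - n) ω + ENNReal.ofReal (M.expansion * M.arrivalU) := by
  obtain ⟨n, hn, d, j, hdj, hd, hsum⟩ :=
    exists_last_departure (fun _ => hM.arrivalU_pos) hU h
  refine ⟨n, hn, ?_⟩
  have hd' : M.delayU (t - n) ω = d := hd
  have e : t + (M.calcDelay : ℤ) = t - n + d + M.calcDelay + j := by
    rw [← hdj]; push_cast; ring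
  rw [M.entryQueueD_of_delayU_eq hd', e]
  refine (backlog_add_le (hM.arrivalD_nonneg ω) hD _ j).trans ?_
  refine add_le_add le_rfl (ENNReal.ofReal_le_ofReal ?_)
  refine le_trans ?_ (mul_le_mul_of_nonneg_left hsum hM.expansion_pos.le)
  rw [Finset.mul_sum]
  refine Finset.sum_le_sum fun i _ => mul_le_mul_of_nonneg_left ?_ hM.expansion_pos.le
  -- A downlink arrival comes from the uplink slot `1 + calcDelay` earlier, so these are the `j`
  -- slots bounded by `hsum`.
  rw [show t - (n : ℤ) + d + M.calcDelay + 1 + i - 1 - M.calcDelay = t - n + d + i by ring]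
  exact departure_le _ hU _

theorem IsAdmissible.measureReal_lt_entryQueueD_le (hM : M.IsAdmissible P) (t : ℤ) (c : ℝ≥0∞)
    (m : ℕ) : P.real {ω | c < M.entryQueueD t ω}
      ≤ (m + 1) * P.real {ω | c < M.queueD 0 ω} + P.real {ω | (m : ℕ∞) < M.delayU t ω} := by
  have hsub : {ω | c < M.entryQueueD t ω} ⊆
      (⋃ n ∈ Finset.range (m + 1), {ω | c < M.queueD (t + n + M.calcDelay) ω})
        ∪ {ω | (m : ℕ∞) < M.delayU t ω} := by
    intro ω hω
    simp only [Set.mem_union, Set.mem_iUnion, Set.mem_ofPred_eq, Finset.mem_range,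
      exists_prop] at hω ⊢
    by_cases h : (m : ℕ∞) < M.delayU t ω
    · exact Or.inr h
    · obtain ⟨n, hn⟩ :=
        ENat.ne_top_iff_exists.1 (ne_top_of_le_ne_top (ENat.natCast_ne_top m) (not_lt.1 h))
      rw [← hn, not_lt, Nat.cast_le] at h
      rw [M.entryQueueD_of_delayU_eq hn.symm] at hω
      exact Or.inl ⟨n, Nat.lt_succ_of_le h, hω⟩
  have hstat : ∀ n : ℕ, P.real {ω | c < M.queueD (t + n + M.calcDelay) ω}
      = P.real {ω | c < M.queueD 0 ω} := fun n => by
    rw [measureReal_def, measureReal_def, hM.measure_lt_queueD c _ 0]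
  refine (measureReal_mono hsub).trans ((measureReal_union_le _ _).trans ?_)
  refine add_le_add_left ((measureReal_biUnion_finset_le _ _).trans (le_of_eq ?_)) _
  rw [Finset.sum_congr rfl fun n _ => hstat n, Finset.sum_const, Finset.card_range,
    nsmul_eq_mul, Nat.cast_add_one]

/-- Union bound over the packages that may have been the last to leave; stationarity moves all of
them to epoch `t`. -/
theorem IsAdmissible.measureReal_lt_queueD_le (hM : M.IsAdmissible P) (t : ℤ) {s : ℝ} (hs : 0 ≤ s)
    (m : ℕ) : P.real {ω | ENNReal.ofReal (s + M.expansion * M.arrivalU) < M.queueD 0 ω}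
      ≤ (m + 1) * P.real {ω | ENNReal.ofReal s < M.entryQueueD t ω}
        + P.real {ω | (m : ℕ∞) < M.delayU t ω} := by
  have hb : 0 ≤ M.expansion * M.arrivalU := mul_nonneg hM.expansion_pos.le hM.arrivalU_pos.le
  have hsub : {ω | ENNReal.ofReal (s + M.expansion * M.arrivalU) < M.queueD (t + M.calcDelay) ω}
      ≤ᵐ[P] ((⋃ n ∈ Finset.range (m + 1), {ω | ENNReal.ofReal s < M.entryQueueD (t - n) ω})
        ∪ {ω | (m : ℕ∞) < M.delayU (t - m) ω} : Set Ω) := by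
    filter_upwards [hM.ae_rate_nonneg] with ω hω
    intro (hlt : _ < _)
    by_cases h : (m : ℕ∞) < M.delayU (t - m) ω
    · exact Or.inr h
    · left
      obtain ⟨n, hn, hle⟩ := hM.exists_queueD_le hω.1 hω.2 (not_lt.1 h)
      refine Set.mem_biUnion (x := n) (by simpa using Nat.lt_succ_of_le hn) ?_
      have h2 := hlt.trans_le hle
      rw [ENNReal.ofReal_add hs hb] at h2
      exact lt_of_add_lt_add_right h2
  have h1 : P.real {ω | ENNReal.ofReal (s + M.expansion * M.arrivalU) < M.queueD 0 ω}
      = P.real {ω | ENNReal.ofReal (s + M.expansion * M.arrivalU)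
        < M.queueD (t + M.calcDelay) ω} := by
    simp only [measureReal_def, hM.measure_lt_queueD _ 0 (t + M.calcDelay)]
  have h2 : P.real {ω | (m : ℕ∞) < M.delayU t ω} = P.real {ω | (m : ℕ∞) < M.delayU (t - m) ω} := by
    simp only [measureReal_def, hM.measure_lt_delayU _ t (t - m)]
  have hstat : ∀ n : ℕ, P.real {ω | ENNReal.ofReal s < M.entryQueueD (t - n) ω}
      = P.real {ω | ENNReal.ofReal s < M.entryQueueD t ω} := fun n => by
    rw [measureReal_def, measureReal_def, hM.measure_lt_entryQueueD _ (t - n) t]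
  rw [h1, h2]
  refine (ENNReal.toReal_mono (measure_ne_top _ _) (measure_mono_ae hsub)).trans
    ((measureReal_union_le _ _).trans ?_)
  refine add_le_add_left ((measureReal_biUnion_finset_le _ _).trans (le_of_eq ?_)) _
  rw [Finset.sum_congr rfl fun n _ => hstat n, Finset.sum_const, Finset.card_range,
    nsmul_eq_mul, Nat.cast_add_one]

/-! ### Positivity of the effective capacities -/

theorem _root_.effectiveCapacity_mul {R : Ω → ℝ} {θ : ℝ} (hθ : 0 < θ) :
    θ * effectiveCapacity P R θ = -Real.log (mgf R P (-θ)) := by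
  unfold effectiveCapacity mgf
  field_simp

theorem _root_.effectiveCapacity_pos {R : Ω → ℝ} (hR : Measurable R) (hnn : ∀ᵐ ω ∂P, 0 ≤ R ω)
    {θ : ℝ} (hθ : 0 < θ) (h : mgf R P (-θ) < 1) : 0 < effectiveCapacity P R θ := by
  have hpos : 0 < mgf R P (-θ) := mgf_pos (integrable_exp_neg_mul hR.aemeasurable hnn hθ.le)
  have h1 := Real.log_neg hpos h
  have h2 := effectiveCapacity_mul (P := P) (R := R) hθ
  exact pos_of_mul_pos_right (by linarith : 0 < θ * effectiveCapacity P R θ) hθ.le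

/-- Otherwise the service vanishes almost surely and the constant arrivals pile up beyond every
level. -/
theorem IsAdmissible.mgf_rateU_lt_one (hM : M.IsAdmissible P) {θ θu : ℝ} (hθ : 0 < θ) (hθu : 0 < θu)
    (hu : IsOverflowDecayRate P (M.queueU 0) θu) : mgf (M.rateU 0) P (-θ) < 1 := by
  by_contra hc
  rw [not_lt] at hc
  have hz : ∀ t, ∀ᵐ ω ∂P, M.rateU t ω = 0 := fun t => by
    rw [← mgf_congr_identDistrib (hM.identDistrib_rateU t)] at hc
    exact ae_eq_zero_of_one_le_integral_exp (measurable_rateU (hM.measurable_snr t).1).aemeasurable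
      ((hM.rate_nonneg t).mono fun _ h => h.1) hθ hc
  obtain ⟨s, hs, hne⟩ := hu.exists_measure_ne_one hθu
  refine hne (measure_eq_one_of_ae ?_)
  filter_upwards [ae_all_iff.2 hz] with ω hω
  obtain ⟨n, hn⟩ := exists_nat_ge (s / M.arrivalU)
  rw [div_le_iff₀ hM.arrivalU_pos] at hn
  unfold queueU backlog
  refine le_trans ?_ (le_iSup _ n)
  refine ENNReal.ofReal_le_ofReal ?_
  simp only [hω, Finset.sum_const, Finset.card_range, nsmul_eq_mul]
  push_cast
  nlinarith [hM.arrivalU_pos]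

/-- Without downlink service the backlog contains all past arrivals. These dominate sums of
independent nonnegative variables that do not vanish almost surely, and Chernoff's bound shows that
such sums exceed every level. -/
theorem IsAdmissible.mgf_rateD_lt_one (hM : M.IsAdmissible P) {θ θu θd : ℝ} (hθ : 0 < θ)
    (hθu : 0 < θu) (hθd : 0 < θd) (hu : IsOverflowDecayRate P (M.queueU 0) θu)
    (hd : IsOverflowDecayRate P (M.queueD 0) θd) : mgf (M.rateD 0) P (-θ) < 1 := by
  by_contra hc
  rw [not_lt] at hc
  have hz : ∀ t, ∀ᵐ ω ∂P, M.rateD t ω = 0 := fun t => by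
    rw [← mgf_congr_identDistrib (hM.identDistrib_rateD t)] at hc
    exact ae_eq_zero_of_one_le_integral_exp (measurable_rateD (hM.measurable_snr t).2).aemeasurable
      ((hM.rate_nonneg t).mono fun _ h => h.2) hθ hc
  obtain ⟨s, hs, hne⟩ := hd.exists_measure_ne_one hθd
  have hcpos := hM.expansion_pos
  have hlam := hM.arrivalU_pos
  -- a lower bound for the arrivals of the downlink that is independent over the slots
  set Y : ℤ → Ω → ℝ := fun t ω => M.expansion * min M.arrivalU (M.rateU t ω) with hY
  have hg : Measurable fun p : ℝ × ℝ => M.expansion * min M.arrivalU (M.up.rate p.1) :=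
    (measurable_const.min M.measurable_up_rate_fst).const_mul _
  have hYm : ∀ t, Measurable (Y t) := fun t =>
    (measurable_const.min (measurable_rateU (hM.measurable_snr t).1)).const_mul _
  have hYnn : ∀ t, ∀ᵐ ω ∂P, 0 ≤ Y t ω := fun t => by
    filter_upwards [hM.rate_nonneg t] with ω hω
    exact mul_nonneg hcpos.le (le_min hlam.le hω.1)
  have hψ : mgf (Y 0) P (-1) < 1 := by
    by_contra hc'
    have hY0 := ae_eq_zero_of_one_le_integral_exp (hYm 0).aemeasurable (hYnn 0) one_pos
      (not_lt.1 hc')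
    have hR0 : ∀ᵐ ω ∂P, M.rateU 0 ω = 0 := by
      filter_upwards [hY0, hM.rate_nonneg 0] with ω h1 h2
      have h3 : min M.arrivalU (M.rateU 0 ω) = 0 := by
        simpa [hY, hcpos.ne'] using h1
      rcases min_choice M.arrivalU (M.rateU 0 ω) with h | h
      · linarith
      · linarith
    have h1 := hM.mgf_rateU_lt_one one_pos hθu hu
    rw [mgf, integral_congr_ae (g := fun _ => (1 : ℝ)) (by
      filter_upwards [hR0] with ω hω; simp [hω])] at h1
    simp at h1
  have hψ0 : 0 < mgf (Y 0) P (-1) :=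
    mgf_pos (integrable_exp_neg_mul (hYm 0).aemeasurable (hYnn 0) one_pos.le)
  -- `e j` is the uplink slot whose output reaches the downlink at epoch `-j`.
  set e : ℕ → ℤ := fun j => 0 - j - 1 - M.calcDelay with he
  have hinj : Function.Injective e := fun i j hij => by
    simp only [he] at hij
    omega
  have hbound : ∀ n : ℕ, P.real {ω | M.queueD 0 ω < ENNReal.ofReal s}
      ≤ Real.exp s * mgf (Y 0) P (-1) ^ n := by
    intro n
    have hsub : {ω | M.queueD 0 ω < ENNReal.ofReal s}
        ≤ᵐ[P] {ω | (∑ k ∈ Finset.range n, Y (e k) ω) ≤ s} := by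
      filter_upwards [ae_all_iff.2 hz, hM.ae_rate_nonneg] with ω hω hω'
      intro (hlt : _ < _)
      change _ ≤ s
      have h1 : ENNReal.ofReal (∑ j ∈ Finset.range (n + 1), M.arrivalD ω (0 - j))
          ≤ M.queueD 0 ω := by
        refine le_trans (le_of_eq ?_) (le_iSup _ n)
        simp [hω]
      have h2 := h1.trans_lt hlt
      have h3 : ∑ j ∈ Finset.range (n + 1), M.arrivalD ω (0 - j) < s :=
        lt_of_not_ge fun h => h2.not_ge (ENNReal.ofReal_le_ofReal h)
      refine le_trans ?_ h3.le
      rw [Finset.sum_range_succ]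
      refine le_add_of_le_of_nonneg (Finset.sum_le_sum fun j _ => ?_) (hM.arrivalD_nonneg ω _)
      exact mul_le_mul_of_nonneg_left (min_le_departure (fun _ => M.arrivalU)
        (r := fun k => M.rateU k ω) (e j)) hcpos.le
    refine (ENNReal.toReal_mono (measure_ne_top _ _) (measure_mono_ae hsub)).trans ?_
    have hsum : ∀ᵐ ω ∂P, 0 ≤ ∑ k ∈ Finset.range n, Y (e k) ω := by
      filter_upwards [ae_all_iff.2 hYnn] with ω hω using Finset.sum_nonneg fun _ _ => hω _
    have hint := integrable_exp_neg_mul (P := P)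
      (Finset.measurable_fun_sum (Finset.range n) fun k _ => hYm (e k)).aemeasurable hsum
      zero_le_one
    have h4 := measure_le_le_exp_mul_mgf (μ := P) s (by norm_num : (-1 : ℝ) ≤ 0) hint
    have h5 : mgf (fun ω => ∑ k ∈ Finset.range n, Y (e k) ω) P (-1) = mgf (Y 0) P (-1) ^ n :=
      integral_exp_neg_sum hYm (hM.iIndepFun_comp hg) (hM.identDistrib_comp hg) 1 hinj n
    rw [h5] at h4
    simpa [measureReal_def] using h4
  have hlim : Tendsto (fun n : ℕ => Real.exp s * mgf (Y 0) P (-1) ^ n) atTop (𝓝 0) := by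
    simpa using (tendsto_pow_atTop_nhds_zero_of_lt_one hψ0.le hψ).const_mul (Real.exp s)
  have hzero : P.real {ω | M.queueD 0 ω < ENNReal.ofReal s} = 0 :=
    le_antisymm (ge_of_tendsto' hlim hbound) measureReal_nonneg
  refine hne (measure_eq_one_of_ae ?_)
  rw [measureReal_eq_zero_iff] at hzero
  have : ∀ᵐ ω ∂P, ¬ M.queueD 0 ω < ENNReal.ofReal s := measure_eq_zero_iff_ae_notMem.1 hzero
  filter_upwards [this] with ω hω using not_lt.1 hω

end ControlLoop

/-! ### Asymptotics of thresholds and of unions -/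

/-- An integer is at least `x` exactly when it exceeds `⌈x⌉₊ - 1`; positivity of `x` keeps the
natural subtraction from truncating. -/
theorem ofReal_le_toENNReal_iff {x : ℝ} (hx : 0 < x) (D : ℕ∞) :
    ENNReal.ofReal x ≤ (D : ℝ≥0∞) ↔ ((⌈x⌉₊ - 1 : ℕ) : ℕ∞) < D := by
  induction D using ENat.recTopCoe with
  | top => exact iff_of_true (by simp) (ENat.natCast_lt_top _)
  | coe d =>
    rw [ENat.toENNReal_coe, ENNReal.ofReal_le_natCast, Nat.cast_lt, ← Nat.ceil_le]
    have := Nat.ceil_pos.2 hx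
    omega

theorem tendsto_log_div_of_nat {p : ℕ → ℝ} {f : ℝ → ℝ} {κ : ℝ}
    (hp : Tendsto (fun m : ℕ => Real.log (p m) / m) atTop (𝓝 κ))
    (hf : ∀ x, 0 < x → f x = p (⌈x⌉₊ - 1)) :
    Tendsto (fun x : ℝ => Real.log (f x) / x) atTop (𝓝 κ) := by
  have hn : Tendsto (fun x : ℝ => ⌈x⌉₊ - 1) atTop atTop :=
    (tendsto_sub_atTop_nat 1).comp tendsto_nat_ceil_atTop
  have h1 : Tendsto (fun x : ℝ => ((⌈x⌉₊ - 1 : ℕ) : ℝ) / x) atTop (𝓝 1) := by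
    have h2 : Tendsto (fun x : ℝ => (⌈x⌉₊ : ℝ) / x - x⁻¹) atTop (𝓝 (1 - 0)) :=
      (tendsto_nat_ceil_div_atTop (R := ℝ)).sub tendsto_inv_atTop_zero
    rw [sub_zero] at h2
    refine h2.congr' ?_
    filter_upwards [eventually_gt_atTop 0] with x hx
    rw [Nat.cast_sub (Nat.ceil_pos.2 hx), Nat.cast_one]
    ring
  have h3 := (hp.comp hn).mul h1
  rw [mul_one] at h3
  refine h3.congr' ?_
  filter_upwards [eventually_gt_atTop 0, hn.eventually (eventually_gt_atTop 0)] with x hx hnx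
  have : (0 : ℝ) < ((⌈x⌉₊ - 1 : ℕ) : ℝ) := by exact_mod_cast hnx
  rw [hf x hx]
  simp only [Function.comp]
  field_simp

theorem isEquivalent_neg_log_div {f : ℝ → ℝ} {κ : ℝ} (hκ : 0 < κ)
    (h : Tendsto (fun x : ℝ => Real.log (f x) / x) atTop (𝓝 (-κ))) :
    (fun x : ℝ => -Real.log (f x) / κ) ~[atTop] fun x => x := by
  rw [Asymptotics.isEquivalent_iff_tendsto_one
    ((eventually_gt_atTop 0).mono fun x hx => ne_of_gt hx)]
  have h1 := h.const_mul (-κ⁻¹)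
  rw [neg_mul_neg, inv_mul_cancel₀ hκ.ne'] at h1
  refine h1.congr fun x => ?_
  simp only [Pi.div_apply]
  ring

theorem tendsto_zero_of_log_div {f : ℝ → ℝ} {κ : ℝ} (hκ : 0 < κ) (hf : ∀ x, 0 < f x)
    (h : Tendsto (fun x : ℝ => Real.log (f x) / x) atTop (𝓝 (-κ))) :
    Tendsto f atTop (𝓝[>] 0) := by
  refine tendsto_nhdsWithin_iff.2 ⟨?_, Eventually.of_forall hf⟩
  have h1 : Tendsto (fun x : ℝ => Real.log (f x) / x * x) atTop atBot :=
    h.neg_mul_atTop (by linarith) tendsto_id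
  refine (Real.tendsto_exp_atBot.comp h1).congr' ?_
  filter_upwards [eventually_gt_atTop 0] with x hx
  simp only [Function.comp]
  rw [div_mul_cancel₀ _ hx.ne', Real.exp_log (hf x)]

/-- On the logarithmic scale, the probability of a union depends only on the logarithms of the
probabilities of its two parts. -/
theorem log_union_isEquivalent {ι : Type*} {l : Filter ι} {u d u' d' C : ι → ℝ}
    (hu : ∀ᶠ i in l, 0 < u i) (hd : ∀ᶠ i in l, 0 < d i)
    (hu' : Tendsto u' l (𝓝[>] 0)) (hd' : Tendsto d' l (𝓝[>] 0))
    (hul : (fun i => Real.log (u i)) ~[l] fun i => Real.log (u' i))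
    (hdl : (fun i => Real.log (d i)) ~[l] fun i => Real.log (d' i))
    (hC : ∀ i, max (u i) (d i) ≤ C i ∧ C i ≤ u i + d i) :
    (fun i => Real.log (C i)) ~[l] fun i => Real.log (1 - (1 - u' i) * (1 - d' i)) := by
  have hbound : ∀ {a b c : ℝ}, 0 < a → 0 < b → max a b ≤ c → c ≤ a + b →
      max (Real.log a) (Real.log b) ≤ Real.log c ∧
        Real.log c ≤ max (Real.log a) (Real.log b) + Real.log 2 := by
    intro a b c ha hb h1 h2
    have hc : 0 < c := ha.trans_le ((le_max_left _ _).trans h1)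
    refine ⟨max_le (Real.log_le_log ha ((le_max_left _ _).trans h1))
      (Real.log_le_log hb ((le_max_right _ _).trans h1)), ?_⟩
    rcases le_total a b with h | h
    · have := Real.log_le_log hc (show c ≤ b * 2 by linarith)
      rw [Real.log_mul hb.ne' two_ne_zero] at this
      exact this.trans (add_le_add (le_max_right _ _) le_rfl)
    · have := Real.log_le_log hc (show c ≤ a * 2 by linarith)
      rw [Real.log_mul ha.ne' two_ne_zero] at this
      exact this.trans (add_le_add (le_max_left _ _) le_rfl)
  have hl2 : 0 < Real.log 2 := Real.log_pos one_lt_two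
  refine Asymptotics.isLittleO_iff.2 fun c hc => ?_
  -- Half of the allowed error `c` covers replacing `u`, `d` by `u'`, `d'`. The other half covers
  -- two errors of size `log 2`, which `B` makes at most `c / 2` times the absolute value of the
  -- target logarithm.
  set η := min (c / 2) 1 with hη
  have hη0 : 0 < η := lt_min (by linarith) one_pos
  have hη1 : η ≤ 1 := min_le_right _ _
  have hηc : η ≤ c / 2 := min_le_left _ _
  set B := 4 * Real.log 2 / c + Real.log 2 with hB
  have hB0 : 0 < B := by positivity
  have hlu := Real.tendsto_log_nhdsGT_zero.comp hu'
  have hld := Real.tendsto_log_nhdsGT_zero.comp hd'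
  have hmem : ∀ {f : ι → ℝ}, Tendsto f l (𝓝[>] 0) → ∀ᶠ i in l, 0 < f i ∧ f i < 1 := fun h =>
    h.eventually (Ioo_mem_nhdsGT one_pos)
  filter_upwards [hu, hd, hmem hu', hmem hd', hul.isLittleO.def hη0, hdl.isLittleO.def hη0,
    hlu.eventually (eventually_le_atBot (-B)), hld.eventually (eventually_le_atBot (-B))]
    with i hu hd hu' hd' h1 h2 ha hb
  obtain ⟨c1, c2⟩ := hbound hu hd (hC i).1 (hC i).2
  -- The product formula also lies between the maximum and the sum of `u'` and `d'`.
  obtain ⟨x1, x2⟩ := hbound (c := 1 - (1 - u' i) * (1 - d' i)) hu'.1 hd'.1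
    (max_le (by nlinarith [mul_pos hu'.1 hd'.1, mul_pos hd'.1 (sub_pos.2 hu'.2)])
      (by nlinarith [mul_pos hu'.1 hd'.1, mul_pos hu'.1 (sub_pos.2 hd'.2)]))
    (by nlinarith [mul_pos hu'.1 hd'.1])
  simp only [Function.comp, Pi.sub_apply, Real.norm_eq_abs] at h1 h2 ha hb ⊢
  set X := Real.log (1 - (1 - u' i) * (1 - d' i))
  set L := Real.log (C i)
  set a := Real.log (u' i)
  set b := Real.log (d' i)
  set y := Real.log (u i)
  set z := Real.log (d i)
  rw [abs_of_nonpos (by linarith : a ≤ 0), abs_le] at h1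
  rw [abs_of_nonpos (by linarith : b ≤ 0), abs_le] at h2
  set m := max a b with hm
  have hmB : m ≤ -B := max_le ha hb
  have hlo : (1 + η) * m ≤ max y z := by
    rcases max_choice a b with h | h
    · rw [hm, h]; exact le_trans (by linarith) (le_max_left _ _)
    · rw [hm, h]; exact le_trans (by linarith) (le_max_right _ _)
  have hup : max y z ≤ (1 - η) * m := by
    have e1 : (1 - η) * a ≤ (1 - η) * m :=
      mul_le_mul_of_nonneg_left (le_max_left _ _) (by linarith)
    have e2 : (1 - η) * b ≤ (1 - η) * m :=
      mul_le_mul_of_nonneg_left (le_max_right _ _) (by linarith)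
    exact max_le (by linarith) (by linarith)
  have hXB : X ≤ -(4 * Real.log 2 / c) := by linarith
  have hX0 : X ≤ 0 := hXB.trans (by rw [neg_nonpos]; positivity)
  have hcX : 4 * Real.log 2 ≤ c * (-X) := by
    have h4 : 4 * Real.log 2 / c ≤ -X := by linarith
    rw [div_le_iff₀ hc] at h4
    linarith
  have hηX : η * (-X) ≤ c / 2 * (-X) := mul_le_mul_of_nonneg_right hηc (by linarith)
  have hηm : η * (-m) ≤ η * (-X) + Real.log 2 := by
    have h5 : η * (-m) ≤ η * (-X + Real.log 2) := mul_le_mul_of_nonneg_left (by linarith) hη0.le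
    have h6 : η * Real.log 2 ≤ Real.log 2 := by nlinarith
    linarith
  rw [abs_of_nonpos hX0, abs_le]
  constructor <;> linarith

namespace ControlLoop

variable {Ω : Type*} [MeasurableSpace Ω] {P : Measure Ω} [IsProbabilityMeasure P]
  {M : ControlLoop Ω}

/-! ### Decay of the delays -/

theorem IsAdmissible.tendsto_log_delayU (hM : M.IsAdmissible P) {θ : ℝ} (hθ : 0 < θ)
    (hu : IsOverflowDecayRate P (M.queueU 0) θ) (t : ℤ) :
    (∀ m : ℕ, 0 < P.real {ω | (m : ℕ∞) < M.delayU t ω}) ∧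
      Tendsto (fun m : ℕ => Real.log (P.real {ω | (m : ℕ∞) < M.delayU t ω}) / m) atTop
        (𝓝 (-(θ * M.capU P θ))) := by
  have hQ : HasDecayRate P (M.queueU t) θ := by
    have h0 := hu.hasDecayRate hθ
    unfold HasDecayRate at h0 ⊢
    simp only [measureReal_def] at h0 ⊢
    simpa only [hM.measure_lt_queueU _ t 0] using h0
  rw [capU, effectiveCapacity_mul hθ, neg_neg]
  refine tendsto_log_delay_div (fun k => measurable_rateU (hM.measurable_snr k).1)
    hM.iIndepFun_rateU hM.identDistrib_rateU (fun k => (hM.rate_nonneg k).mono fun _ h => h.1) hθ hQ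
    t (fun _ => measureReal_nonneg) fun m => ?_
  rw [measureReal_def, ENNReal.ofReal_toReal (measure_ne_top _ _)]
  exact hM.measure_lt_delayU_eq_lintegral t m

theorem IsAdmissible.capU_pos (hM : M.IsAdmissible P) {θ : ℝ} (hθ : 0 < θ)
    (hu : IsOverflowDecayRate P (M.queueU 0) θ) : 0 < M.capU P θ :=
  effectiveCapacity_pos (measurable_rateU (hM.measurable_snr 0).1)
    ((hM.rate_nonneg 0).mono fun _ h => h.1) hθ (hM.mgf_rateU_lt_one hθ hθ hu)

/-- Half the true rate leaves room for a clean exponential bound, the error term needed in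
`HasDecayRate.of_sandwich`. -/
theorem IsAdmissible.exists_delayU_le_exp (hM : M.IsAdmissible P) {θ : ℝ} (hθ : 0 < θ)
    (hu : IsOverflowDecayRate P (M.queueU 0) θ) (t : ℤ) :
    ∃ ρ > 0, ∀ᶠ m : ℕ in atTop, P.real {ω | (m : ℕ∞) < M.delayU t ω} ≤ Real.exp (-ρ * m) := by
  obtain ⟨hpos, h⟩ := hM.tendsto_log_delayU hθ hu t
  have hκ := mul_pos hθ (hM.capU_pos hθ hu)
  refine ⟨θ * M.capU P θ / 2, half_pos hκ, ?_⟩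
  filter_upwards [h.eventually (gt_mem_nhds (by linarith :
    -(θ * M.capU P θ) < -(θ * M.capU P θ / 2))), eventually_gt_atTop 0] with m hm hm0
  rw [div_lt_iff₀ (by exact_mod_cast hm0)] at hm
  exact (Real.log_le_iff_le_exp (hpos m)).1 hm.le

theorem IsAdmissible.ae_delayU_ne_top (hM : M.IsAdmissible P) {θ : ℝ} (hθ : 0 < θ)
    (hu : IsOverflowDecayRate P (M.queueU 0) θ) (t : ℤ) : ∀ᵐ ω ∂P, M.delayU t ω ≠ ⊤ := by
  obtain ⟨ρ, hρ, h⟩ := hM.exists_delayU_le_exp hθ hu t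
  have hlim : Tendsto (fun m : ℕ => Real.exp (-ρ * m)) atTop (𝓝 0) :=
    Real.tendsto_exp_atBot.comp
      (tendsto_natCast_atTop_atTop.const_mul_atTop_of_neg (neg_neg_of_pos hρ))
  have h0 : P.real {ω | M.delayU t ω = ⊤} = 0 := by
    refine le_antisymm (ge_of_tendsto hlim (h.mono fun m hm => le_trans ?_ hm)) measureReal_nonneg
    refine measureReal_mono fun ω hω => ?_
    rw [Set.mem_ofPred_eq] at hω ⊢
    rw [hω]
    exact ENat.natCast_lt_top m
  rw [measureReal_eq_zero_iff] at h0
  exact measure_eq_zero_iff_ae_notMem.1 h0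

/-- The random entry epoch costs only a factor linear in the level, so the exponential rate of the
stationary queue persists. -/
theorem IsAdmissible.hasDecayRate_entryQueueD (hM : M.IsAdmissible P) {θu θd : ℝ} (hθu : 0 < θu)
    (hθd : 0 < θd) (hu : IsOverflowDecayRate P (M.queueU 0) θu)
    (hd : IsOverflowDecayRate P (M.queueD 0) θd) (t : ℤ) :
    HasDecayRate P (M.entryQueueD t) θd := by
  obtain ⟨ρ, hρ, h⟩ := hM.exists_delayU_le_exp hθu hu t
  exact (hd.hasDecayRate hθd).of_sandwich hθd hρ h
    (fun s n => hM.measureReal_lt_entryQueueD_le t _ n)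
    fun s n hs => hM.measureReal_lt_queueD_le t hs n

theorem IsAdmissible.capD_pos (hM : M.IsAdmissible P) {θu θd : ℝ} (hθu : 0 < θu)
    (hθd : 0 < θd) (hu : IsOverflowDecayRate P (M.queueU 0) θu)
    (hd : IsOverflowDecayRate P (M.queueD 0) θd) : 0 < M.capD P θd :=
  effectiveCapacity_pos (measurable_rateD (hM.measurable_snr 0).2)
    ((hM.rate_nonneg 0).mono fun _ h => h.2) hθd (hM.mgf_rateD_lt_one hθd hθu hθd hu hd)

theorem IsAdmissible.tendsto_log_delayD (hM : M.IsAdmissible P) {θu θd : ℝ} (hθu : 0 < θu)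
    (hθd : 0 < θd) (hu : IsOverflowDecayRate P (M.queueU 0) θu)
    (hd : IsOverflowDecayRate P (M.queueD 0) θd) (t : ℤ) :
    (∀ m : ℕ, 0 < P.real {ω | (m : ℕ∞) < M.delayD t ω}) ∧
      Tendsto (fun m : ℕ => Real.log (P.real {ω | (m : ℕ∞) < M.delayD t ω}) / m) atTop
        (𝓝 (-(θd * M.capD P θd))) := by
  rw [capD, effectiveCapacity_mul hθd, neg_neg]
  refine tendsto_log_delay_div (fun k => measurable_rateD (hM.measurable_snr k).2)
    hM.iIndepFun_rateD hM.identDistrib_rateD (fun k => (hM.rate_nonneg k).mono fun _ h => h.2) hθd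
    (hM.hasDecayRate_entryQueueD hθu hθd hu hd t) 0 (fun _ => measureReal_nonneg) fun m => ?_
  rw [measureReal_def, ENNReal.ofReal_toReal (measure_ne_top _ _)]
  exact hM.measure_lt_delayD_eq_lintegral t m (hM.ae_delayU_ne_top hθu hu t)

/-! ### Loss probabilities -/

theorem lossEventU_eq {Ω : Type*} (M : ControlLoop Ω) (t : ℤ) {x : ℝ} (hx : 0 < x) :
    M.lossEventU t x = {ω | ((⌈x⌉₊ - 1 : ℕ) : ℕ∞) < M.delayU t ω} :=
  Set.ext fun _ => ofReal_le_toENNReal_iff hx _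

theorem lossEventD_eq {Ω : Type*} (M : ControlLoop Ω) (t : ℤ) {x : ℝ} (hx : 0 < x) :
    M.lossEventD t x = {ω | ((⌈x⌉₊ - 1 : ℕ) : ℕ∞) < M.delayD t ω} :=
  Set.ext fun _ => ofReal_le_toENNReal_iff hx _

theorem lossEventU_of_nonpos {Ω : Type*} (M : ControlLoop Ω) (t : ℤ) {x : ℝ} (hx : x ≤ 0) :
    M.lossEventU t x = Set.univ :=
  Set.eq_univ_of_forall fun ω => show ENNReal.ofReal x ≤ _ by
    rw [ENNReal.ofReal_of_nonpos hx]; exact zero_le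

theorem lossEventD_of_nonpos {Ω : Type*} (M : ControlLoop Ω) (t : ℤ) {x : ℝ} (hx : x ≤ 0) :
    M.lossEventD t x = Set.univ :=
  Set.eq_univ_of_forall fun ω => show ENNReal.ofReal x ≤ _ by
    rw [ENNReal.ofReal_of_nonpos hx]; exact zero_le

theorem IsAdmissible.measurableSet_lossEventD (hM : M.IsAdmissible P) (t : ℤ) (y : ℝ) :
    MeasurableSet (M.lossEventD t y) := by
  rcases le_or_gt y 0 with h | h
  · rw [M.lossEventD_of_nonpos t h]; exact MeasurableSet.univ
  · rw [M.lossEventD_eq t h]; exact measurableSet_lt_delayD hM.measurable_snr t _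

theorem IsAdmissible.lossC_add_inter (hM : M.IsAdmissible P) (t : ℤ) (x y : ℝ) :
    M.lossC P t x y + P.real (M.lossEventU t x ∩ M.lossEventD t y)
      = M.lossU P t x + M.lossD P t y :=
  measureReal_union_add_inter (hM.measurableSet_lossEventD t y)

theorem lossC_bounds (M : ControlLoop Ω) (t : ℤ) (x y : ℝ) :
    max (M.lossU P t x) (M.lossD P t y) ≤ M.lossC P t x y ∧
      M.lossC P t x y ≤ M.lossU P t x + M.lossD P t y :=
  ⟨max_le (measureReal_mono Set.subset_union_left) (measureReal_mono Set.subset_union_right),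
    measureReal_union_le _ _⟩

theorem IsAdmissible.tendsto_log_lossU (hM : M.IsAdmissible P) {θ : ℝ} (hθ : 0 < θ)
    (hu : IsOverflowDecayRate P (M.queueU 0) θ) (t : ℤ) :
    (∀ x, 0 < M.lossU P t x) ∧
      Tendsto (fun x : ℝ => Real.log (M.lossU P t x) / x) atTop (𝓝 (-(θ * M.capU P θ))) := by
  obtain ⟨hpos, h⟩ := hM.tendsto_log_delayU hθ hu t
  refine ⟨fun x => ?_, tendsto_log_div_of_nat h fun x hx => by rw [lossU, M.lossEventU_eq t hx]⟩
  rcases le_or_gt x 0 with hx | hx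
  · simp [lossU, M.lossEventU_of_nonpos t hx]
  · rw [lossU, M.lossEventU_eq t hx]; exact hpos _

theorem IsAdmissible.tendsto_log_lossD (hM : M.IsAdmissible P) {θu θd : ℝ} (hθu : 0 < θu)
    (hθd : 0 < θd) (hu : IsOverflowDecayRate P (M.queueU 0) θu)
    (hd : IsOverflowDecayRate P (M.queueD 0) θd) (t : ℤ) :
    (∀ y, 0 < M.lossD P t y) ∧
      Tendsto (fun y : ℝ => Real.log (M.lossD P t y) / y) atTop (𝓝 (-(θd * M.capD P θd))) := by
  obtain ⟨hpos, h⟩ := hM.tendsto_log_delayD hθu hθd hu hd t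
  refine ⟨fun y => ?_, tendsto_log_div_of_nat h fun y hy => by rw [lossD, M.lossEventD_eq t hy]⟩
  rcases le_or_gt y 0 with hy | hy
  · simp [lossD, M.lossEventD_of_nonpos t hy]
  · rw [lossD, M.lossEventD_eq t hy]; exact hpos _

/-! ### The maximum cycle time -/

theorem maxCycleTime_eq {Ω : Type*} (M : ControlLoop Ω) {x y : ℝ} (hx : 0 ≤ x) (hy : 0 ≤ y) :
    M.maxCycleTime x y = x + y + (M.sensingDelay + M.calcDelay) := by
  refine IsGreatest.csSup_eq ⟨⟨x, ⟨hx, le_rfl⟩, y, ⟨hy, le_rfl⟩, by ring⟩, ?_⟩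
  rintro T ⟨a, ha, b, hb, rfl⟩
  linarith [ha.2, hb.2]

theorem cycleTime_lt {Ω : Type*} (M : ControlLoop Ω) {t : ℤ} {x y : ℝ} {ω : Ω}
    (h : ω ∉ M.lossEventU t x ∪ M.lossEventD t y) :
    (M.cycleTime t ω : ℝ≥0∞) < ENNReal.ofReal (M.maxCycleTime x y) := by
  have hU : (M.delayU t ω : ℝ≥0∞) < ENNReal.ofReal x := not_le.1 fun hc => h (Or.inl hc)
  have hD : (M.delayD t ω : ℝ≥0∞) < ENNReal.ofReal y := not_le.1 fun hc => h (Or.inr hc)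
  -- A package can escape loss only if both thresholds are positive, so the explicit form of
  -- `maxCycleTime` applies.
  have hx : 0 < x := ENNReal.ofReal_pos.1 (lt_of_le_of_lt zero_le hU)
  have hy : 0 < y := ENNReal.ofReal_pos.1 (lt_of_le_of_lt zero_le hD)
  obtain ⟨a, ha⟩ := ENat.ne_top_iff_exists.1 fun hc : M.delayU t ω = ⊤ => by simp [hc] at hU
  obtain ⟨b, hb⟩ := ENat.ne_top_iff_exists.1 fun hc : M.delayD t ω = ⊤ => by simp [hc] at hD
  rw [← ha, ENat.toENNReal_coe, ENNReal.natCast_lt_ofReal] at hU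
  rw [← hb, ENat.toENNReal_coe, ENNReal.natCast_lt_ofReal] at hD
  have e : M.cycleTime t ω = ((M.sensingDelay + a + M.calcDelay + b : ℕ) : ℕ∞) := by
    rw [cycleTime, ← ha, ← hb]; push_cast; rfl
  rw [e, ENat.toENNReal_coe, ENNReal.natCast_lt_ofReal, M.maxCycleTime_eq hx.le hy.le]
  push_cast
  linarith

theorem maxCycleTime_isEquivalent {Ω : Type*} (M : ControlLoop Ω) :
    (fun p : ℝ × ℝ => M.maxCycleTime p.1 p.2) ~[atTop] fun p => p.1 + p.2 := by
  have h1 : Tendsto (fun p : ℝ × ℝ => p.1) atTop atTop := by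
    rw [← prod_atTop_atTop_eq]; exact tendsto_fst
  have h2 : Tendsto (fun p : ℝ × ℝ => p.2) atTop atTop := by
    rw [← prod_atTop_atTop_eq]; exact tendsto_snd
  have hsum : Tendsto (fun p : ℝ × ℝ => p.1 + p.2) atTop atTop := h1.atTop_add_atTop h2
  have hlo : (fun _ : ℝ × ℝ => (M.sensingDelay + M.calcDelay : ℝ)) =o[atTop]
      fun p : ℝ × ℝ => p.1 + p.2 :=
    Asymptotics.isLittleO_const_left.2 (Or.inr (tendsto_norm_atTop_atTop.comp hsum))
  refine (Asymptotics.IsEquivalent.refl.add_isLittleO hlo).congr_left ?_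
  filter_upwards [h1.eventually_ge_atTop 0, h2.eventually_ge_atTop 0] with p hp1 hp2
  exact (M.maxCycleTime_eq hp1 hp2).symm

end ControlLoop

/-! ### Assembly of the theorem. -/

theorem theorem1 {Ω : Type*} [MeasurableSpace Ω] (P : Measure Ω) [IsProbabilityMeasure P]
    (M : ControlLoop Ω) (hM : M.IsAdmissible P)
    (θu θd : ℝ) (hθu : 0 < θu) (hθd : 0 < θd)
    (hu : IsOverflowDecayRate P (M.queueU 0) θu)
    (hd : IsOverflowDecayRate P (M.queueD 0) θd) (t : ℤ) :
    -- the delay thresholds and the package loss probabilities of the two queues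
    (0 < M.capU P θu ∧ 0 < M.capD P θd) ∧
    ((fun x : ℝ => -Real.log (M.lossU P t x) / (θu * M.capU P θu)) ~[atTop] fun x => x) ∧
    ((fun y : ℝ => -Real.log (M.lossD P t y) / (θd * M.capD P θd)) ~[atTop] fun y => y) ∧
    -- the maximum cycle time
    (∀ x y : ℝ, ∀ ω, ω ∉ M.lossEventU t x ∪ M.lossEventD t y →
      (M.cycleTime t ω : ℝ≥0∞) < ENNReal.ofReal (M.maxCycleTime x y)) ∧
    (∀ x y : ℝ, 0 ≤ x → 0 ≤ y →
      M.maxCycleTime x y = x + y + (M.sensingDelay + M.calcDelay)) ∧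
    ((fun p : ℝ × ℝ => M.maxCycleTime p.1 p.2) ~[atTop] fun p => p.1 + p.2) ∧
    -- the package loss probability of the loop
    (∀ x y : ℝ,
      |M.lossC P t x y - (1 - (1 - M.lossU P t x) * (1 - M.lossD P t y))|
        ≤ min (M.lossU P t x) (M.lossD P t y)) ∧
    (∀ x y : ℝ, IndepSet (M.lossEventU t x) (M.lossEventD t y) P →
      M.lossC P t x y = 1 - (1 - M.lossU P t x) * (1 - M.lossD P t y)) ∧
    ((fun p : ℝ × ℝ => Real.log (M.lossC P t p.1 p.2)) ~[atTop]
      fun p => Real.log (1 - (1 - M.lossU P t p.1) * (1 - M.lossD P t p.2))) ∧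
    ((fun ε : ℝ × ℝ => Real.log (M.lossC P t
        (-Real.log ε.1 / (θu * M.capU P θu)) (-Real.log ε.2 / (θd * M.capD P θd))))
      ~[𝓝[>] 0 ×ˢ 𝓝[>] 0] fun ε => Real.log (1 - (1 - ε.1) * (1 - ε.2))) := by
  have hcU := hM.capU_pos hθu hu
  have hcD := hM.capD_pos hθu hθd hu hd
  have hκU := mul_pos hθu hcU
  have hκD := mul_pos hθd hcD
  obtain ⟨hposU, hlogU⟩ := hM.tendsto_log_lossU hθu hu t
  obtain ⟨hposD, hlogD⟩ := hM.tendsto_log_lossD hθu hθd hu hd t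
  have heqU := isEquivalent_neg_log_div hκU hlogU
  have heqD := isEquivalent_neg_log_div hκD hlogD
  refine ⟨⟨hcU, hcD⟩, heqU, heqD, fun x y ω => M.cycleTime_lt, fun x y => M.maxCycleTime_eq,
    M.maxCycleTime_isEquivalent, fun x y => ?_, fun x y hind => ?_, ?_, ?_⟩
  -- By inclusion-exclusion the difference is `ε_u ε_d` minus the probability of the intersection,
  -- two numbers between zero and `min ε_u ε_d`.
  · have h1 := hM.lossC_add_inter t x y
    set i := P.real (M.lossEventU t x ∩ M.lossEventD t y)
    have hi0 : 0 ≤ i := measureReal_nonneg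
    have hiU : i ≤ M.lossU P t x := measureReal_mono Set.inter_subset_left
    have hiD : i ≤ M.lossD P t y := measureReal_mono Set.inter_subset_right
    have hU1 : M.lossU P t x ≤ 1 := measureReal_le_one
    have hD1 : M.lossD P t y ≤ 1 := measureReal_le_one
    have hU0 := (hposU x).le
    have hD0 := (hposD y).le
    have h2 : M.lossU P t x * M.lossD P t y ≤ M.lossU P t x := mul_le_of_le_one_right hU0 hD1
    have h3 : M.lossU P t x * M.lossD P t y ≤ M.lossD P t y := mul_le_of_le_one_left hD0 hU1
    have h4 := mul_nonneg hU0 hD0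
    rw [abs_le]
    have h5 := le_min hiU hiD
    have h6 := le_min h2 h3
    constructor <;> linarith
  · have h1 := hM.lossC_add_inter t x y
    have h2 : P.real (M.lossEventU t x ∩ M.lossEventD t y) = M.lossU P t x * M.lossD P t y := by
      have hi : P (M.lossEventU t x ∩ M.lossEventD t y)
          = P (M.lossEventU t x) * P (M.lossEventD t y) := by
        exact (Indep_iff _ _ _).1 hind _ _
          (MeasurableSpace.measurableSet_generateFrom rfl)
          (MeasurableSpace.measurableSet_generateFrom rfl)
      simp only [ControlLoop.lossU, ControlLoop.lossD, measureReal_def, hi, ENNReal.toReal_mul]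
    rw [h2] at h1
    linarith
  · have h1 : Tendsto (fun p : ℝ × ℝ => p.1) atTop atTop := by
      rw [← prod_atTop_atTop_eq]; exact tendsto_fst
    have h2 : Tendsto (fun p : ℝ × ℝ => p.2) atTop atTop := by
      rw [← prod_atTop_atTop_eq]; exact tendsto_snd
    exact log_union_isEquivalent (Eventually.of_forall fun p => hposU p.1)
      (Eventually.of_forall fun p => hposD p.2)
      ((tendsto_zero_of_log_div hκU hposU hlogU).comp h1)
      ((tendsto_zero_of_log_div hκD hposD hlogD).comp h2)
      Asymptotics.IsEquivalent.refl Asymptotics.IsEquivalent.refl fun p => M.lossC_bounds t p.1 p.2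
  -- As `ε` tends to zero its threshold tends to infinity, so the delay asymptotics give an actual
  -- loss probability with logarithm equivalent to `log ε`.
  · have hthr : ∀ {κ : ℝ} {f : ℝ → ℝ}, 0 < κ →
        ((fun x : ℝ => -Real.log (f x) / κ) ~[atTop] fun x => x) →
        (fun ε : ℝ => Real.log (f (-Real.log ε / κ))) ~[𝓝[>] 0] fun ε => Real.log ε := by
      intro κ f hκ h
      have hlim : Tendsto (fun ε : ℝ => -Real.log ε / κ) (𝓝[>] 0) atTop :=
        (tendsto_neg_atBot_atTop.comp Real.tendsto_log_nhdsGT_zero).atTop_div_const hκ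
      have h1 := (Asymptotics.IsEquivalent.refl (u := fun _ : ℝ => -κ)).mul (h.comp_tendsto hlim)
      refine (h1.congr_left (Eventually.of_forall fun ε => ?_)).congr_right
        (Eventually.of_forall fun ε => ?_)
      · simp only [Pi.mul_apply, Function.comp]; field_simp
      · simp only [Pi.mul_apply, Function.comp]; field_simp
    exact log_union_isEquivalent (Eventually.of_forall fun p => hposU _)
      (Eventually.of_forall fun p => hposD _) tendsto_fst tendsto_snd
      ((hthr hκU heqU).comp_tendsto tendsto_fst) ((hthr hκD heqD).comp_tendsto tendsto_snd)
      fun p => M.lossC_bounds t _ _
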